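/- Let $0<r_1<\dots<r_K$ be rates and let $\theta=(\theta_1,\dots,\theta_K)\in\mathcal T\cap\mathcal U$, where $\mathcal T=\{\eta\in[0,1]^K:\eta_1\ge\dots\ge\eta_K\}$ and $\mathcal U$ is the set of $\eta\in[0,1]^K$ for which there is an index $k_0$ with $r_1\eta_1<\dots<r_{k_0}\eta_{k_0}$ and $r_{k_0}\eta_{k_0}>\dots>r_K\eta_K$. Let $k^\star$ be the (unique) maximiser of $k\mapsto r_k\theta_k$. In each slot $n=1,2,\dots$ a rate index $k(n)$ is selected; the $i$-th selection of $k$ yields the reward $r_kX_k(i)$, where for each $k$ the variables $X_k(1),X_k(2),\dots$ are i.i.d. Bernoulli with mean $\theta_k$ (outcomes of different rates may be dependent in any way). The regret is $R(T)=r_{k^\star}\theta_{k^\star}T-\sum_k r_k\theta_k\,\mathbb E[\#\{n\le T:k(n)=k\}]$. Put $I(p,q)=p\log\frac pq+(1-p)\log\frac{1-p}{1-q}\in[0,\infty]$ (with $0\log\frac0b=0$, $a\log\frac a0=\infty$ for $a>0$), let $N(k)=\{l\in\{k-1,k+1\}\cap\{1,\dots,K\}:r_k\theta_k\le r_l\}$,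 and $$c(\theta)=\sum_{k\in N(k^\star)}\frac{r_{k^\star}\theta_{k^\star}-r_k\theta_k}{I\big(\theta_k,\frac{r_{k^\star}\theta_{k^\star}}{r_k}\big)},$$ a term with infinite denominator being $0$. The ORS (Optimal Rate Sampling) algorithm with constant $c>0$ is defined as follows. Let $t_k(n)$ be the number of slots before $n$ in which $k$ was selected, $\hat\mu_k(n)=\frac1{t_k(n)}\sum_{i=1}^{t_k(n)}r_kX_k(i)$, let the leader $L(n)$ be an element of $\arg\max_k\hat\mu_k(n)$ (for $n\le K$, where some averages are not defined yet, $L(n)$ is arbitrary), and let $l_k(n)=\#\{n'<n:L(n')=k\}$. Let $\mathcal N(k)=\{k-1,k,k+1\}\cap\{1,\dots,K\}$ and $$b_k(n)=\max\Big\{q\in[0,r_k]:t_k(n)\,I\Big(\tfrac{\hat\mu_k(n)}{r_k},\tfrac q{r_k}\Big)\le\log l_{L(n)}(n)+c\log\log l_{L(n)}(n)\Big\},$$ where all the $b_k(n)$ are set to $0$ if the right-hand side is negative or if $l_{L(n)}(n)\le1$. For $n=1,\dots,K$ set $k(n)=n$. For $n>K$, set $k(n)=L(n)$ if $(l_{L(n)}(n)-1)/3\in\mathbb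 N=\{0,1,2,\dots\}$; otherwise $k(n)$ is an element of $\mathcal N(L(n))$ with largest $b_k(n)$. Ties are broken arbitrarily. Then, under the ORS algorithm with any constant $c>0$: 1. for every $\epsilon>0$, $R(T)\le(1+\epsilon)\,c(\theta)\log T+O(\log\log T)$ as $T\to\infty$; 2. consequently $\limsup_{T\to\infty}R(T)/\log T\le c(\theta)$, i.e. ORS is asymptotically optimal; 3. for every $k\ne k^\star$, $\mathbb E[l_k(T)]=O(\log\log T)$. The constants hidden in the $O$-terms depend only on $K$, $(r_k)$, $\theta$, $c$ and, in 1., $\epsilon$; in particular they depend neither on the way ties are broken nor on the joint law of the outcomes at different rates. -/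

import Mathlib

open MeasureTheory ProbabilityTheory Filter Asymptotics

universe u

noncomputable section

namespace RateSelection

/-! The `K` rates are indexed by `Fin K`; the index `k : Fin K` stands for the `(k+1)`-st smallest
rate. Slots are numbered `1, 2, 3, …` (the value at `0` of a sequence indexed by slots is never
used). -/

/-! ### Bernoulli Kullback-Leibler divergence -/

/-- The extended-real number `a log (a / b)`, with the conventions `0 log (0 / b) = 0` and
`a log (a / 0) = +∞` for `a ≠ 0`. -/
def klTerm (a b : ℝ) : EReal :=
  open Classical in
  if a = 0 then 0 else if b = 0 then ⊤ else ((a * Real.log (a / b) : ℝ) : EReal)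

/-- `I(p, q) = p log (p/q) + (1-p) log ((1-p)/(1-q))`, for `p, q ∈ [0,1]`, with values in
`[0, +∞]`. -/
def bernoulliKL (p q : ℝ) : EReal :=
  klTerm p q + klTerm (1 - p) (1 - q)

/-! ### Structure of the parameter -/

/-- `𝒯`: vectors of success probabilities that are non-increasing in the rate. -/
def monotoneParams (K : ℕ) : Set (Fin K → ℝ) :=
  {η | (∀ k, η k ∈ Set.Icc (0 : ℝ) 1) ∧ Antitone η}

/-- `𝒰`: vectors of success probabilities for which the throughput `r k * η k` is strictly
increasing up to some index and strictly decreasing from that index on. -/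
def unimodalParams {K : ℕ} (r : Fin K → ℝ) : Set (Fin K → ℝ) :=
  {η | (∀ k, η k ∈ Set.Icc (0 : ℝ) 1) ∧
    ∃ k₀ : Fin K, StrictMonoOn (fun k => r k * η k) (Set.Iic k₀) ∧
      StrictAntiOn (fun k => r k * η k) (Set.Ici k₀)}

/-- `k` and `l` are consecutive indices. -/
def Adjacent {K : ℕ} (k l : Fin K) : Prop :=
  l.val + 1 = k.val ∨ k.val + 1 = l.val

/-- `𝒩(k)`: the index `k` and its (one or two) neighbours. -/
def neighborhood {K : ℕ} (k : Fin K) : Set (Fin K) :=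
  {l | l = k ∨ Adjacent k l}

/-- `N(k)`: the neighbours `l` of `k` with `r k * θ k ≤ r l`. -/
def competitors {K : ℕ} (r θ : Fin K → ℝ) (k : Fin K) : Set (Fin K) :=
  {l | Adjacent k l ∧ r k * θ k ≤ r l}

/-- `c(θ) = ∑_{k ∈ N(k⋆)} (r_{k⋆} θ_{k⋆} - r_k θ_k) / I(θ_k, r_{k⋆} θ_{k⋆} / r_k)`. The quotients
are taken in the extended reals, so that a term whose divergence is `+∞` is zero. -/
def regretConstant {K : ℕ} (r θ : Fin K → ℝ) (kstar : Fin K) : ℝ :=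
  open Classical in
  ∑ k ∈ Finset.univ.filter (fun k => k ∈ competitors r θ kstar),
    (((r kstar * θ kstar - r k * θ k : ℝ) : EReal) /
      bernoulliKL (θ k) (r kstar * θ kstar / r k)).toReal

/-! ### The algorithm -/

/-- Number of slots `m` with `1 ≤ m < n` and `a m = k`. For the sequence of selections this is
`t_k(n)`, for the sequence of leaders it is `l_k(n)`. -/
def countBefore {K : ℕ} (a : ℕ → Fin K) (k : Fin K) (n : ℕ) : ℕ :=
  ((Finset.Ico 1 n).filter (fun m => a m = k)).card

/-- The empirical average reward `μ̂_k(n)` of rate `k` before slot `n`: `x k i` is the outcome of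
the `(i+1)`-st transmission at rate `k`. -/
def empiricalMean {K : ℕ} (r : Fin K → ℝ) (x : Fin K → ℕ → ℝ) (sel : ℕ → Fin K)
    (k : Fin K) (n : ℕ) : ℝ :=
  (1 / (countBefore sel k n : ℝ)) * ∑ i ∈ Finset.range (countBefore sel k n), r k * x k i

/-- The set of `q ∈ [0, r_k]` with
`t_k(n) I(μ̂_k(n) / r_k, q / r_k) ≤ log l + c log (log l)`, where `l` is the number of times
the current leader has already been leader. If `l ≤ 1`, then `log (log l)` is `-∞` or undefined,
and no `q` qualifies. -/
def indexSet {K : ℕ} (r : Fin K → ℝ) (c : ℝ) (x : Fin K → ℕ → ℝ) (L sel : ℕ → Fin K)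
    (k : Fin K) (n : ℕ) : Set ℝ :=
  {q | q ∈ Set.Icc 0 (r k) ∧ 2 ≤ countBefore L (L n) n ∧
    ((countBefore sel k n : ℝ) : EReal) *
        bernoulliKL (empiricalMean r x sel k n / r k) (q / r k) ≤
      ((Real.log (countBefore L (L n) n : ℝ) +
        c * Real.log (Real.log (countBefore L (L n) n : ℝ)) : ℝ) : EReal)}

/-- The index `b_k(n)`: the largest element of `indexSet`. When the right-hand side of the
defining inequality is negative or undefined (which does not depend on `k`), all the sets are
empty and all the indices are equal to `0`, so that all candidates tie. -/
def index {K : ℕ} (r : Fin K → ℝ) (c : ℝ) (x : Fin K → ℕ → ℝ) (L sel : ℕ → Fin K)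
    (k : Fin K) (n : ℕ) : ℝ :=
  sSup (indexSet r c x L sel k n)

/-- For the table of outcomes `x`, the leaders `L 1, L 2, …` and the selections `sel 1, sel 2, …`
follow the ORS algorithm with constant `c`. Ties, both for the leader and for the largest index,
are broken arbitrarily; in the first `K` slots, where some empirical averages are not defined yet,
the leader is arbitrary. -/
structure IsORSPath {K : ℕ} (r : Fin K → ℝ) (c : ℝ) (x : Fin K → ℕ → ℝ)
    (L sel : ℕ → Fin K) : Prop where
  /-- In the slots `1, …, K` every rate is selected once, in increasing order. -/
  init : ∀ k : Fin K, sel (k.val + 1) = k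
  /-- The leader has the largest empirical average. -/
  leader : ∀ n, K < n → ∀ k, empiricalMean r x sel k n ≤ empiricalMean r x sel (L n) n
  /-- If `(l_{L(n)}(n) - 1) / 3` is a natural number, the leader is selected. -/
  select_leader : ∀ n, K < n → (∃ m : ℕ, countBefore L (L n) n = 3 * m + 1) → sel n = L n
  /-- Otherwise a rate with the largest index in the neighbourhood of the leader is selected. -/
  select_index : ∀ n, K < n → (¬ ∃ m : ℕ, countBefore L (L n) n = 3 * m + 1) →
    sel n ∈ neighborhood (L n) ∧
      ∀ k ∈ neighborhood (L n), index r c x L sel k n ≤ index r c x L sel (sel n) n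

/-! ### The stochastic model -/

/-- For every rate `k`, the outcomes `X k 0, X k 1, …` of the successive transmissions at that rate
are i.i.d. Bernoulli variables with mean `θ k`. Outcomes at different rates may be dependent in
any way. -/
structure IsBernoulliOutcomes {K : ℕ} {Ω : Type*} [MeasurableSpace Ω] (P : Measure Ω)
    (θ : Fin K → ℝ) (X : Fin K → ℕ → Ω → ℝ) : Prop where
  measurable : ∀ k i, Measurable (X k i)
  binary : ∀ k i, ∀ᵐ ω ∂P, X k i ω = 0 ∨ X k i ω = 1
  mean : ∀ k i, ∫ ω, X k i ω ∂P = θ k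
  indep : ∀ k, iIndepFun (X k) P

/-- A run of the ORS algorithm with constant `c` under the success probabilities `θ`: random
outcomes `X`, random leaders `L` and random selections `sel` that almost surely follow the
algorithm. -/
structure IsORSRun {K : ℕ} {Ω : Type*} [MeasurableSpace Ω] (P : Measure Ω)
    (r θ : Fin K → ℝ) (c : ℝ) (X : Fin K → ℕ → Ω → ℝ) (L sel : ℕ → Ω → Fin K) : Prop where
  outcomes : IsBernoulliOutcomes P θ X
  measurable_leader : ∀ n, Measurable (L n)
  measurable_sel : ∀ n, Measurable (sel n)
  path : ∀ᵐ ω ∂P, IsORSPath r c (fun k i => X k i ω) (fun n => L n ω) (fun n => sel n ω)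

/-- The regret `R(T) = r_{k⋆} θ_{k⋆} T - ∑_k r_k θ_k E[t_k(T)]`, where `t_k(T)` is here the number
of selections of rate `k` in the slots `1, …, T`. -/
def regret {K : ℕ} {Ω : Type*} [MeasurableSpace Ω] (P : Measure Ω) (r θ : Fin K → ℝ)
    (kstar : Fin K) (sel : ℕ → Ω → Fin K) (T : ℕ) : ℝ :=
  r kstar * θ kstar * T -
    ∑ k, r k * θ k * ∫ ω, (countBefore (fun n => sel n ω) k (T + 1) : ℝ) ∂P

end RateSelection

end

open RateSelection

/-! The proof confines all randomness to one variable `w`, built from the outcomes alone, whose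
expectation is bounded in terms of the parameters (`exists_concentration_time`). On a `Concentrated`
path, the mean of `t > w` observations of any rate is within `t^(-1/4)` of the truth. Moreover, for
a level `q k` slightly below `θ k`, the quantity `exp (t I(p̂, q k))` stays below `w` whenever `p̂ ≤
q k`. Everything else is a deterministic estimate along such a path.

Suppose a suboptimal `k` leads. By unimodality it has exactly one better neighbour `b`. Forced
selections make the mean of `k` accurate once it has led often, so `b` cannot have been sampled
much: an accurate mean would make `b` beat `k`. Still, the index of `b` is at least `r b * θ b - δ`,
since otherwise the evidence bound would force the leader count below `w`. A different selected rate
`j` must beat this index with a distinctly smaller mean, which limits its past selections to `O(w +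
log N)`, where `N` is the final leader count. Forced slots make up about a third, so `N ≤ N/3 + O(1
+ w + log N)` and hence `N = O(1 + w)` (`exists_countBefore_suboptimal_leader_le`). The expected
time under a wrong leader is therefore even bounded.

Suppose `k⋆` leads. Selecting a neighbour `k` requires its index to reach the empirical mean of
`k⋆`, close to `r k⋆ * θ k⋆`. This gives `t_k I(θ k, r k⋆ θ k⋆ / r k) ≲ log T + c log log T`
(`rarelySelected_of_lt_rate`). If `r k < r k⋆ θ k⋆` the index is capped by `r k`; if equality holds
the divergence is infinite, and the polynomial accuracy `t^(-1/4)` shows that only `O(1 + w)`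
selections occur (`rarelySelected_of_rate_eq`). Summing over rates and integrating `w` gives the
regret bound. -/

namespace RateSelection

/-! ### Bernoulli divergence, real-valued version -/

/-- The Bernoulli divergence as a real number; it agrees with `bernoulliKL p q` for `0 < q < 1`. -/
noncomputable def klReal (p q : ℝ) : ℝ :=
  p * Real.log (p / q) + (1 - p) * Real.log ((1 - p) / (1 - q))

theorem klTerm_of_ne {a b : ℝ} (hb : b ≠ 0) :
    klTerm a b = ((a * Real.log (a / b) : ℝ) : EReal) := by
  unfold klTerm
  split_ifs with h
  · simp [h]
  · rfl

theorem bernoulliKL_eq_klReal {p q : ℝ} (h0 : 0 < q) (h1 : q < 1) :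
    bernoulliKL p q = ((klReal p q : ℝ) : EReal) := by
  unfold bernoulliKL klReal
  rw [klTerm_of_ne h0.ne', klTerm_of_ne (sub_pos.mpr h1).ne']
  norm_cast

/-- Apply `log y ≤ y - 1` to `y = √q / √p`. Added over the two outcomes, the linear terms cancel and
the divergence dominates the squared Hellinger distance; this leads to a weak Pinsker inequality. -/
theorem sq_sqrt_sub_le_mul_log {p q : ℝ} (hp : 0 ≤ p) (hq : 0 < q) :
    (p - q) + (√p - √q) ^ 2 ≤ p * Real.log (p / q) := by
  rcases hp.eq_or_lt with rfl | hp
  · simp [Real.sq_sqrt hq.le]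
  have h := Real.log_le_sub_one_of_pos (show 0 < √q / √p by positivity)
  have e : Real.log (p / q) = -2 * Real.log (√q / √p) := by
    rw [Real.log_div hp.ne' hq.ne', Real.log_div (by positivity) (by positivity),
      Real.log_sqrt hq.le, Real.log_sqrt hp.le]
    ring
  have e2 : p * (√q / √p) = √p * √q := by
    have : p = √p * √p := (Real.mul_self_sqrt hp.le).symm
    have h3 : √p ≠ 0 := by positivity
    field_simp
    nlinarith
  have e3 := Real.sq_sqrt hp.le
  have e4 := Real.sq_sqrt hq.le
  have := mul_le_mul_of_nonneg_left h hp.le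
  rw [e]
  nlinarith

theorem sq_sub_le_four_mul_sq_sqrt_sub {p q : ℝ} (hp : 0 ≤ p) (hp1 : p ≤ 1) (hq : 0 ≤ q)
    (hq1 : q ≤ 1) : (p - q) ^ 2 ≤ 4 * (√p - √q) ^ 2 := by
  have e3 := Real.sq_sqrt hp
  have e4 := Real.sq_sqrt hq
  have a1 : √p ≤ 1 := Real.sqrt_le_one.mpr hp1
  have a2 : √q ≤ 1 := Real.sqrt_le_one.mpr hq1
  have e : (p - q) ^ 2 = (√p - √q) ^ 2 * (√p + √q) ^ 2 := by
    rw [← mul_pow, ← e3, ← e4]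
    simp only [Real.sqrt_sq (Real.sqrt_nonneg _)]
    ring
  have : (√p + √q) ^ 2 ≤ 4 := by
    nlinarith [Real.sqrt_nonneg p, Real.sqrt_nonneg q]
  rw [e]
  nlinarith [sq_nonneg (√p - √q)]

theorem half_sq_sub_le_klReal {p q : ℝ} (hp : 0 ≤ p) (hp1 : p ≤ 1) (hq : 0 < q) (hq1 : q < 1) :
    (p - q) ^ 2 / 2 ≤ klReal p q := by
  have h1 := sq_sqrt_sub_le_mul_log hp hq
  have h2 := sq_sqrt_sub_le_mul_log (sub_nonneg.mpr hp1) (sub_pos.mpr hq1)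
  have h3 := sq_sub_le_four_mul_sq_sqrt_sub hp hp1 hq.le hq1.le
  have h4 := sq_sub_le_four_mul_sq_sqrt_sub (sub_nonneg.mpr hp1) (by linarith : 1 - p ≤ 1)
    (sub_nonneg.mpr hq1.le) (by linarith)
  unfold klReal
  nlinarith

theorem klReal_nonneg {p q : ℝ} (hp : 0 ≤ p) (hp1 : p ≤ 1) (hq : 0 < q) (hq1 : q < 1) :
    0 ≤ klReal p q :=
  le_trans (by positivity) (half_sq_sub_le_klReal hp hp1 hq hq1)

theorem mul_log_div_add {p a q : ℝ} (ha : 0 < a) (hq : 0 < q) :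
    p * Real.log (p / q) = p * Real.log (p / a) + p * Real.log (a / q) := by
  by_cases h : p = 0
  · simp [h]
  · rw [Real.log_div h hq.ne', Real.log_div h ha.ne', Real.log_div ha.ne' hq.ne']; ring

/-- The difference `klReal p q - klReal p a` is affine in `p`, has slope `log (a/q) - log
((1-a)/(1-q)) ≤ 0`, and equals `klReal a q` at `p = a`. This yields monotonicity of the divergence
under nested intervals, and later an exponential gain in the evidence bound. -/
theorem klReal_add_le {p a q : ℝ} (hpa : p ≤ a) (haq : a ≤ q) (ha : 0 < a)
    (hq1 : q < 1) : klReal p a + klReal a q ≤ klReal p q := by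
  have hq : 0 < q := by linarith
  have h1 := mul_log_div_add (p := p) ha hq
  have h2 := mul_log_div_add (p := 1 - p) (show 0 < 1 - a by linarith) (show 0 < 1 - q by linarith)
  have h3 : Real.log (a / q) ≤ 0 := Real.log_nonpos (by positivity) (by rw [div_le_one hq]; exact haq)
  have h4 : 0 ≤ Real.log ((1 - a) / (1 - q)) :=
    Real.log_nonneg (by rw [le_div_iff₀ (by linarith)]; linarith)
  unfold klReal
  rw [h1, h2]
  nlinarith [mul_nonneg (sub_nonneg.mpr hpa) (sub_nonneg.mpr (h3.trans h4))]

theorem klReal_le_klReal {p p' q' q : ℝ} (hp : 0 ≤ p) (hp' : 0 < p') (h1 : p ≤ p') (h2 : p' ≤ q')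
    (h3 : q' ≤ q) (hq : q < 1) : klReal p' q' ≤ klReal p q := by
  have a := klReal_add_le h1 (h2.trans h3) hp' hq
  have b := klReal_add_le h2 h3 (by linarith) hq
  have c := klReal_nonneg hp (by linarith) hp' (by linarith)
  have d := klReal_nonneg (p := q') (q := q) (by linarith) (by linarith) (by linarith) hq
  linarith

/-! ### Consequences of an upper bound on the extended divergence -/

theorem klTerm_zero_right {a : ℝ} (ha : a ≠ 0) : klTerm a 0 = ⊤ := by
  simp [klTerm, ha]

theorem bernoulliKL_one_of_lt {p : ℝ} (hp : p < 1) : bernoulliKL p 1 = ⊤ := by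
  unfold bernoulliKL
  rw [klTerm_of_ne one_ne_zero, sub_self, klTerm_zero_right (sub_pos.mpr hp).ne',
    EReal.coe_add_top]

theorem bernoulliKL_zero_of_pos {p : ℝ} (hp : 0 < p) : bernoulliKL p 0 = ⊤ := by
  unfold bernoulliKL
  rw [sub_zero, klTerm_of_ne one_ne_zero, klTerm_zero_right hp.ne', EReal.top_add_coe]

theorem not_mul_top_le {t : ℕ} (ht : 0 < t) (F : ℝ) :
    ¬ (((t : ℝ) : EReal) * ⊤ ≤ (F : EReal)) := by
  rw [EReal.coe_mul_top_of_pos (by exact_mod_cast ht)]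
  simp

theorem mul_klReal_le_of_mul_bernoulliKL_le {t : ℕ} {p q F : ℝ} (hq : 0 < q) (hq1 : q < 1)
    (h : ((t : ℝ) : EReal) * bernoulliKL p q ≤ (F : EReal)) : t * klReal p q ≤ F := by
  rw [bernoulliKL_eq_klReal hq hq1] at h
  exact_mod_cast h

theorem mul_klReal_le_of_le {t : ℕ} (ht : 0 < t) {p p' q' q F : ℝ} (hp : 0 ≤ p) (hp' : 0 < p')
    (h1 : p ≤ p') (h2 : p' ≤ q') (h3 : q' ≤ q) (hq' : q' < 1) (hq : q ≤ 1)
    (h : ((t : ℝ) : EReal) * bernoulliKL p q ≤ (F : EReal)) : t * klReal p' q' ≤ F := by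
  rcases hq.eq_or_lt with rfl | hq
  · rw [bernoulliKL_one_of_lt (by linarith)] at h
    exact absurd h (not_mul_top_le ht F)
  · have := mul_klReal_le_of_mul_bernoulliKL_le (by linarith) hq h
    refine le_trans ?_ this
    gcongr
    exact klReal_le_klReal hp hp' h1 h2 h3 hq

theorem mul_sq_le_of_mul_bernoulliKL_le {t : ℕ} (ht : 0 < t) {p q F : ℝ} (hp : 0 ≤ p) (hp1 : p ≤ 1)
    (hq : 0 ≤ q) (hq1 : q ≤ 1) (hF : 0 ≤ F)
    (h : ((t : ℝ) : EReal) * bernoulliKL p q ≤ (F : EReal)) : t * ((p - q) ^ 2 / 2) ≤ F := by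
  rcases hq.eq_or_lt with rfl | hq
  · rcases hp.eq_or_lt with rfl | hp
    · simpa using hF
    · rw [bernoulliKL_zero_of_pos hp] at h
      exact absurd h (not_mul_top_le ht F)
  rcases hq1.eq_or_lt with rfl | hq1
  · rcases hp1.eq_or_lt with rfl | hp1
    · simpa using hF
    · rw [bernoulliKL_one_of_lt hp1] at h
      exact absurd h (not_mul_top_le ht F)
  refine le_trans ?_ (mul_klReal_le_of_mul_bernoulliKL_le hq hq1 h)
  gcongr
  exact half_sq_sub_le_klReal hp hp1 hq hq1

theorem bernoulliKL_self {p : ℝ} : bernoulliKL p p = 0 := by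
  have h : ∀ a : ℝ, klTerm a a = 0 := by
    intro a
    unfold klTerm
    split_ifs with h
    · rfl
    · simp [div_self h]
  simp [bernoulliKL, h]

/-! ### The index -/

variable {K : ℕ} {r θ q : Fin K → ℝ} {c : ℝ} {x : Fin K → ℕ → ℝ} {L sel : ℕ → Fin K}

/-- The empirical mean of the first `t` terms of a sequence. -/
noncomputable def phat (x : ℕ → ℝ) (t : ℕ) : ℝ := (∑ i ∈ Finset.range t, x i) / t

/-- The exploration level `log l + c log log l`. -/
noncomputable def explorationLevel (c : ℝ) (l : ℕ) : ℝ :=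
  Real.log (l : ℝ) + c * Real.log (Real.log (l : ℝ))

theorem empiricalMean_eq (k : Fin K) (n : ℕ) :
    empiricalMean r x sel k n = r k * phat (x k) (countBefore sel k n) := by
  unfold empiricalMean phat
  rw [← Finset.mul_sum]; ring

theorem phat_mem {x : ℕ → ℝ} (hx : ∀ i, x i = 0 ∨ x i = 1) (t : ℕ) :
    0 ≤ phat x t ∧ phat x t ≤ 1 := by
  have h : ∀ i, 0 ≤ x i ∧ x i ≤ 1 := fun i => by rcases hx i with h | h <;> simp [h]
  refine ⟨div_nonneg (Finset.sum_nonneg fun i _ => (h i).1) (by positivity), ?_⟩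
  refine div_le_one_of_le₀ ?_ (by positivity)
  calc ∑ i ∈ Finset.range t, x i ≤ ∑ i ∈ Finset.range t, (1 : ℝ) :=
        Finset.sum_le_sum fun i _ => (h i).2
    _ = t := by simp

theorem mem_indexSet_iff {k : Fin K} (hr : 0 < r k) {n : ℕ} {q : ℝ} :
    q ∈ indexSet r c x L sel k n ↔ q ∈ Set.Icc 0 (r k) ∧ 2 ≤ countBefore L (L n) n ∧
      ((countBefore sel k n : ℝ) : EReal) *
        bernoulliKL (phat (x k) (countBefore sel k n)) (q / r k) ≤
      ((explorationLevel c (countBefore L (L n) n) : ℝ) : EReal) := by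
  unfold indexSet explorationLevel
  rw [empiricalMean_eq, mul_div_cancel_left₀ _ hr.ne']
  rfl

theorem bddAbove_indexSet (k : Fin K) (n : ℕ) : BddAbove (indexSet r c x L sel k n) :=
  ⟨r k, fun _ hq => hq.1.2⟩

theorem exists_mem_indexSet_gt {k : Fin K} {n : ℕ} {y : ℝ} (hy : 0 ≤ y)
    (h : y < index r c x L sel k n) : ∃ q ∈ indexSet r c x L sel k n, y < q := by
  have hne : (indexSet r c x L sel k n).Nonempty := by
    by_contra hne
    rw [Set.not_nonempty_iff_eq_empty] at hne
    -- The supremum of the empty set is `0`, which `0 ≤ y` rules out.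
    rw [index, hne, Real.sSup_empty] at h
    linarith
  exact exists_lt_of_lt_csSup hne h

theorem empiricalMean_le_index {k : Fin K} (hr : 0 < r k) (hx : ∀ i, x k i = 0 ∨ x k i = 1) {n : ℕ}
    (hl : 2 ≤ countBefore L (L n) n)
    (hf : 0 ≤ explorationLevel c (countBefore L (L n) n)) :
    empiricalMean r x sel k n ≤ index r c x L sel k n := by
  refine le_csSup (bddAbove_indexSet k n) ((mem_indexSet_iff hr).2 ⟨?_, hl, ?_⟩)
  · have := phat_mem hx (countBefore sel k n)
    rw [empiricalMean_eq]
    exact ⟨by nlinarith, by nlinarith⟩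
  · rw [empiricalMean_eq, mul_div_cancel_left₀ _ hr.ne', bernoulliKL_self, mul_zero]
    exact_mod_cast hf

theorem explorationLevel_lt_of_index_lt {k : Fin K} (hr : 0 < r k) {n : ℕ} {y : ℝ} (hy : 0 < y)
    (hy1 : y < r k) (hl : 2 ≤ countBefore L (L n) n) (h : index r c x L sel k n < y) :
    explorationLevel c (countBefore L (L n) n) <
      countBefore sel k n * klReal (phat (x k) (countBefore sel k n)) (y / r k) := by
  by_contra! hcon
  refine absurd (le_csSup (bddAbove_indexSet k n) ((mem_indexSet_iff hr).2
    ⟨⟨hy.le, hy1.le⟩, hl, ?_⟩)) (not_le.mpr h)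
  rw [bernoulliKL_eq_klReal (by positivity) (by rwa [div_lt_one hr])]
  exact_mod_cast hcon

/-- The threshold `3 > e` makes `log (log l)` nonnegative. -/
theorem log_le_explorationLevel (hc : 0 ≤ c) {l : ℕ} (hl : 3 ≤ l) :
    Real.log l ≤ explorationLevel c l := by
  have h3 : (3 : ℝ) ≤ l := by exact_mod_cast hl
  have : 1 ≤ Real.log l := by
    rw [Real.le_log_iff_exp_le (by linarith)]
    exact (Real.exp_one_lt_d9.le.trans (by norm_num)).trans h3
  have := mul_nonneg hc (Real.log_nonneg this)
  unfold explorationLevel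
  linarith

theorem explorationLevel_le_mul_log (hc : 0 ≤ c) {l : ℕ} (hl : 2 ≤ l) :
    explorationLevel c l ≤ (1 + c) * Real.log l := by
  have h2 : (2 : ℝ) ≤ l := by exact_mod_cast hl
  have h : 0 < Real.log l := Real.log_pos (by linarith)
  have := mul_le_mul_of_nonneg_left (Real.log_le_sub_one_of_pos h) hc
  unfold explorationLevel
  linarith

theorem explorationLevel_le {T l : ℕ} (hc : 0 ≤ c) (hl : 2 ≤ l) (hT : l ≤ T) :
    explorationLevel c l ≤ Real.log T + c * |Real.log (Real.log T)| := by
  have h2 : (2 : ℝ) ≤ l := by exact_mod_cast hl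
  have hT : (l : ℝ) ≤ T := by exact_mod_cast hT
  have h : 0 < Real.log l := Real.log_pos (by linarith)
  have h' : Real.log l ≤ Real.log T := Real.log_le_log (by linarith) hT
  have := (Real.log_le_log h h').trans (le_abs_self _)
  unfold explorationLevel
  gcongr

/-! ### Counting slots -/

theorem countBefore_succ (a : ℕ → Fin K) (k : Fin K) {n : ℕ} (hn : 1 ≤ n) :
    countBefore a k (n + 1) = countBefore a k n + if a n = k then 1 else 0 := by
  unfold countBefore
  rw [← Finset.insert_Ico_right_eq_Ico_add_one hn, Finset.filter_insert]
  split_ifs with h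
  · rw [Finset.card_insert_of_notMem (by simp)]
  · simp

theorem countBefore_mono (a : ℕ → Fin K) (k : Fin K) : Monotone (countBefore a k) := by
  intro m n h
  unfold countBefore
  gcongr

theorem countBefore_lt (a : ℕ → Fin K) {k : Fin K} {m n : ℕ} (hm : 1 ≤ m) (h : a m = k)
    (hmn : m < n) : countBefore a k m < countBefore a k n := by
  have := countBefore_succ a k hm
  rw [if_pos h] at this
  have := countBefore_mono a k (show m + 1 ≤ n from hmn)
  omega

theorem injOn_countBefore (a : ℕ → Fin K) (k : Fin K) :
    Set.InjOn (countBefore a k) {n | 1 ≤ n ∧ a n = k} := by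
  intro m hm n hn h
  rcases lt_trichotomy m n with hl | hl | hl
  · exact absurd h (countBefore_lt a hm.1 hm.2 hl).ne
  · exact hl
  · exact absurd h (countBefore_lt a hn.1 hn.2 hl).ne'

/-- Each visit to `k` raises its count, so distinct visits have distinct prior counts. This is how
bounds on prior counts become bounds on numbers of slots. -/
theorem card_le_of_countBefore_le {a : ℕ → Fin K} {k : Fin K} {S : Finset ℕ}
    (hS : ∀ n ∈ S, 1 ≤ n ∧ a n = k) {B : ℝ} (hB0 : 0 ≤ B)
    (hB : ∀ n ∈ S, (countBefore a k n : ℝ) ≤ B) : (S.card : ℝ) ≤ B + 1 := by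
  have h : S.card ≤ (Finset.range (⌊B⌋₊ + 1)).card := by
    refine Finset.card_le_card_of_injOn (countBefore a k) (fun n hn => ?_)
      ((injOn_countBefore a k).mono hS)
    simpa [Nat.lt_succ_iff] using Nat.le_floor (hB n hn)
  rw [Finset.card_range] at h
  have h' : (S.card : ℝ) ≤ (⌊B⌋₊ : ℝ) + 1 := by exact_mod_cast h
  linarith [Nat.floor_le hB0]

theorem countBefore_le (a : ℕ → Fin K) (k : Fin K) (n : ℕ) : countBefore a k n ≤ n := by
  unfold countBefore
  refine (Finset.card_filter_le _ _).trans ?_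
  simp

theorem sum_countBefore (a : ℕ → Fin K) (T : ℕ) : ∑ k, countBefore a k (T + 1) = T := by
  unfold countBefore
  rw [← Finset.card_eq_sum_card_fiberwise (f := a) (t := Finset.univ) (by simp)]
  simp

/-! ### Sampling of the leader -/

theorem IsORSPath.one_le_countBefore (h : IsORSPath r c x L sel) (k : Fin K) {n : ℕ} (hn : K < n) :
    1 ≤ countBefore sel k n := by
  have := countBefore_lt sel (show 1 ≤ k.val + 1 by omega) (h.init k)
    (show k.val + 1 < n by omega)
  omega

/-- The floor of `(l + 1) / 3` increases exactly when `l` leaves a value `3m + 1`, which after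
initialisation is a slot where the leader is selected. The term `min n K` pays for the first `K`
slots. -/
theorem IsORSPath.countBefore_leader_add_one_div_three_le (h : IsORSPath r c x L sel) (k : Fin K)
    (n : ℕ) : (countBefore L k (n + 1) + 1) / 3 ≤ countBefore sel k (n + 1) + min n K := by
  induction n with
  | zero => simp [countBefore]
  | succ n ih =>
    rw [countBefore_succ L k (by omega), countBefore_succ sel k (by omega)]
    rcases lt_or_ge K (n + 1) with hn | hn
    · by_cases hL : L (n + 1) = k
      · have hf := h.select_leader (n + 1) hn
        rw [hL] at hf
        by_cases hm : ∃ m, countBefore L k (n + 1) = 3 * m + 1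
        · rw [if_pos hL, if_pos (hf hm)]
          omega
        · have : countBefore L k (n + 1) % 3 ≠ 1 := fun h1 =>
            hm ⟨countBefore L k (n + 1) / 3, by omega⟩
          rw [if_pos hL]
          omega
      · rw [if_neg hL]
        omega
    · split_ifs <;> omega

theorem IsORSPath.countBefore_leader_le (h : IsORSPath r c x L sel) (k : Fin K) (n : ℕ) :
    (countBefore L k n : ℝ) ≤ 3 * countBefore sel k n + 3 * K + 1 := by
  have : countBefore L k n ≤ 3 * countBefore sel k n + 3 * K + 1 := by
    rcases n with _ | n
    · simp [countBefore]
    · have := h.countBefore_leader_add_one_div_three_le k n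
      have : min n K ≤ K := min_le_right _ _
      omega
  exact_mod_cast this

/-- Among the slots in which `k` leads, roughly one in three is a forced selection. -/
theorem card_forced_le (L : ℕ → Fin K) (k : Fin K) {T : ℕ} {S : Finset ℕ}
    (hS : ∀ n ∈ S, 1 ≤ n ∧ n < T ∧ L n = k ∧ ∃ m, countBefore L k n = 3 * m + 1) :
    (S.card : ℝ) ≤ (countBefore L k T + 1) / 3 := by
  have h : S.card ≤ (Finset.range ((countBefore L k T + 1) / 3)).card := by
    refine Finset.card_le_card_of_injOn (fun n => countBefore L k n / 3) (fun n hn => ?_) ?_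
    · obtain ⟨h1, h2, h3, m, hm⟩ := hS n hn
      have := countBefore_lt L h1 h3 h2
      simp only [Finset.coe_range, Set.mem_Iio]
      omega
    · intro n hn n' hn' he
      obtain ⟨h1, h2, h3, m, hm⟩ := hS n hn
      obtain ⟨h1', h2', h3', m', hm'⟩ := hS n' hn'
      refine injOn_countBefore L k ⟨h1, h3⟩ ⟨h1', h3'⟩ ?_
      simp only at he
      omega
  rw [Finset.card_range] at h
  have h3 : 3 * S.card ≤ countBefore L k T + 1 := by omega
  have : (3 : ℝ) * S.card ≤ countBefore L k T + 1 := by exact_mod_cast h3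
  linarith

/-! ### Concentrated outcomes -/

/-- The outcomes `x` are binary, their empirical means are close to `θ` from time `w` on, and the
exponentiated evidence against a mean of at least `q` never exceeds `w`. -/
structure Concentrated (θ q : Fin K → ℝ) (x : Fin K → ℕ → ℝ) (w : ℝ) : Prop where
  nonneg : 0 ≤ w
  binary : ∀ k i, x k i = 0 ∨ x k i = 1
  deviation : ∀ k (t : ℕ), w < t → t * (phat (x k) t - θ k) ^ 4 < 1
  evidence : ∀ k (t : ℕ), 0 < q k → 1 ≤ t → phat (x k) t ≤ q k →
    Real.exp (t * klReal (phat (x k) t) (q k)) ≤ w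

theorem le_sum_rates (hr : ∀ k, 0 < r k) (j : Fin K) : r j ≤ ∑ k, r k :=
  Finset.single_le_sum (fun k _ => (hr k).le) (Finset.mem_univ j)

/-- A deviation below `t^(-1/4)` is below `δ / R`, with `R` the sum of the rates, once `t ≥ (R /
δ)^4`. -/
theorem Concentrated.abs_sub_lt {w δ : ℝ} (hx : Concentrated θ q x w) (hr : ∀ k, 0 < r k)
    (hδ : 0 < δ) {j : Fin K} {t : ℕ} (ht : w < t) (ht0 : ((∑ k, r k) / δ) ^ 4 ≤ t) :
    |r j * phat (x j) t - r j * θ j| < δ := by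
  have h1 := hx.deviation j t ht
  have hR : 0 < ∑ k, r k := (hr j).trans_le (le_sum_rates hr j)
  set d := phat (x j) t - θ j with hd
  have h2 : (∑ k, r k) * |d| < δ := by
    refine lt_of_pow_lt_pow_left₀ 4 hδ.le ?_
    rw [mul_pow, (show Even 4 by decide).pow_abs]
    rw [div_pow, div_le_iff₀ (by positivity)] at ht0
    have : 0 ≤ d ^ 4 := by positivity
    calc (∑ k, r k) ^ 4 * d ^ 4 ≤ t * δ ^ 4 * d ^ 4 := by gcongr
      _ = δ ^ 4 * (t * d ^ 4) := by ring
      _ < δ ^ 4 * 1 := by gcongr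
      _ = δ ^ 4 := by ring
  calc |r j * phat (x j) t - r j * θ j| = r j * |d| := by
        rw [← mul_sub, abs_mul, abs_of_pos (hr j)]
    _ ≤ (∑ k, r k) * |d| := by gcongr; exact le_sum_rates hr j
    _ < δ := h2

/-! ### A suboptimal rate is rarely the leader -/

/-- If `k` has led often enough, is not forced, and has a better neighbour `b`, then the rate that
is selected has been selected few times before. -/
theorem countBefore_sel_le_of_suboptimal_leader (hr : ∀ k, 0 < r k) (hθ : ∀ k, θ k ∈ Set.Icc (0:ℝ) 1)
    (hc : 0 ≤ c) {δ w : ℝ} (hδ : 0 < δ) (hq : ∀ j, q j = (r j * θ j - δ) / r j)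
    (path : IsORSPath r c x L sel) (hx : Concentrated θ q x w) {k b : Fin K}
    (hb : b ∈ neighborhood k) (hkb : r k * θ k + 4 * δ ≤ r b * θ b)
    (hbest : ∀ j ∈ neighborhood k, j ≠ b → r j * θ j ≤ r k * θ k)
    {n : ℕ} (hn : K < n) (hL : L n = k) (hf : ¬ ∃ m : ℕ, countBefore L k n = 3 * m + 1)
    (hl : 3 * (w + ((∑ k, r k) / δ) ^ 4) + 3 * K + 4 < countBefore L k n) :
    (countBefore sel (sel n) n : ℝ) ≤ w + ((∑ k, r k) / δ) ^ 4 +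
      2 * ((∑ k, r k) / δ) ^ 2 * (1 + c) * Real.log (countBefore L k n) := by
  subst hL
  have hw := hx.nonneg
  set R := ∑ k, r k with hR
  set l := countBefore L (L n) n with hldef
  have ht0 : 0 ≤ (R / δ) ^ 4 := by positivity
  have hl3 : 3 ≤ l := by
    have : (3 : ℝ) < l := by linarith [(Nat.cast_nonneg K : (0 : ℝ) ≤ K)]
    exact_mod_cast this.le
  have hl3' : (3 : ℝ) ≤ l := by exact_mod_cast hl3
  have hlog : 0 ≤ Real.log l := Real.log_nonneg (by linarith)
  have hA : 0 ≤ 2 * (R / δ) ^ 2 * (1 + c) * Real.log l := by positivity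
  have htk : w + (R / δ) ^ 4 < countBefore sel (L n) n := by
    have := path.countBefore_leader_le (L n) n
    linarith
  have hk := abs_lt.1 (hx.abs_sub_lt (j := L n) hr hδ (by linarith) (by linarith : (R / δ) ^ 4 ≤ _))
  have hlead := path.leader n hn b
  rw [empiricalMean_eq, empiricalMean_eq] at hlead
  obtain ⟨hsel, hidx⟩ := path.select_index n hn hf
  by_contra! hcon
  set j := sel n with hj
  have hjdev := abs_lt.1 (hx.abs_sub_lt (j := j) hr hδ (by linarith)
    (by linarith : (R / δ) ^ 4 ≤ _))
  have hj1 : 1 ≤ countBefore sel j n := path.one_le_countBefore j hn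
  have hmk : 0 ≤ r (L n) * θ (L n) := mul_nonneg (hr _).le (hθ _).1
  -- If `j = b`, both means are accurate and `b` would beat the leader `k`.
  by_cases hjb : j = b
  · rw [hjb] at hjdev
    linarith
  · have hib : r b * θ b - δ ≤ index r c x L sel b n := by
      by_contra! hlt
      have hrb : r b * θ b - δ < r b := by nlinarith [(hθ b).2, hr b]
      have h1 := explorationLevel_lt_of_index_lt (hr b) (by linarith) hrb
        (by omega : 2 ≤ countBefore L (L n) n) hlt
      rw [← hq] at h1
      have h2 := hx.evidence b (countBefore sel b n) (by rw [hq]; exact div_pos (by linarith) (hr b))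
        -- The mean of `b` lies below `q b` because it does not exceed the accurate mean of the
        -- leader.
        (path.one_le_countBefore b hn) (by rw [hq, le_div_iff₀ (hr b)]; linarith)
      have h3 := log_le_explorationLevel hc hl3
      have h4 : (l : ℝ) ≤ w := by
        rw [← Real.exp_log (show (0 : ℝ) < l by linarith)]
        exact (Real.exp_le_exp.2 (h3.trans h1.le)).trans h2
      linarith [(Nat.cast_nonneg K : (0 : ℝ) ≤ K)]
    obtain ⟨y, hy, hlt⟩ := exists_mem_indexSet_gt (y := r b * θ b - 2 * δ) (by linarith)
      (lt_of_lt_of_le (by linarith) (hib.trans (hidx b hb)))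
    rw [mem_indexSet_iff (hr j)] at hy
    obtain ⟨hyI, -, hy⟩ := hy
    have hfl := explorationLevel_le_mul_log hc (by omega : 2 ≤ l)
    have hp := phat_mem (hx.binary j) (countBefore sel j n)
    have hP := mul_sq_le_of_mul_bernoulliKL_le hj1 hp.1 hp.2 (div_nonneg hyI.1 (hr j).le)
      (div_le_one_of_le₀ hyI.2 (hr j).le) (hlog.trans (log_le_explorationLevel hc hl3)) hy
    have hmj := hbest j hsel hjb
    -- The gap `4δ` is spent here: `y` lies above `r b * θ b - 2δ`, the mean reward of `j` is at
    -- most `r k * θ k + δ ≤ r b * θ b - 3δ`, and one `δ` remains.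
    have hgap : δ / R ≤ y / r j - phat (x j) (countBefore sel j n) := by
      have h1 : δ / R ≤ δ / r j := by
        have := le_sum_rates hr j
        have := hr j
        gcongr
      refine h1.trans ?_
      rw [le_sub_iff_add_le, ← le_sub_iff_add_le', ← sub_div, le_div_iff₀ (hr j)]
      linarith
    have hRp : 0 < R := (hr j).trans_le (le_sum_rates hr j)
    have hsq : (δ / R) ^ 2 ≤ (phat (x j) (countBefore sel j n) - y / r j) ^ 2 := by
      rw [← neg_sub, neg_sq]
      gcongr
    have h5 : (countBefore sel j n : ℝ) * ((δ / R) ^ 2 / 2) ≤ (1 + c) * Real.log l := by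
      refine le_trans ?_ (hP.trans hfl)
      gcongr
    have h6 : (countBefore sel j n : ℝ) ≤ 2 * (R / δ) ^ 2 * (1 + c) * Real.log l := by
      have : (countBefore sel j n : ℝ) =
          2 * (R / δ) ^ 2 * ((countBefore sel j n : ℝ) * ((δ / R) ^ 2 / 2)) := by
        field_simp
      rw [this, mul_assoc (2 * (R / δ) ^ 2)]
      gcongr
    linarith

theorem log_natCast_le {a : ℝ} (ha : 0 < a) (N : ℕ) : Real.log N ≤ a * N + |Real.log a| := by
  rcases Nat.eq_zero_or_pos N with rfl | hN
  · simp
  have hN' : (0 : ℝ) < N := by exact_mod_cast hN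
  have := Real.log_le_sub_one_of_pos (mul_pos ha hN')
  rw [Real.log_mul ha.ne' hN'.ne'] at this
  linarith [neg_abs_le (Real.log a)]

/-- The slots led by `k` are initial, early, forced, or spent on a rate with few previous
selections. Forced slots cost `(N + 1) / 3`, and the last kind costs a multiple of `log N` up to
`O(1 + w)`, so `N` can be absorbed on the left. -/
theorem exists_countBefore_suboptimal_leader_le (hr : ∀ k, 0 < r k)
    (hθ : ∀ k, θ k ∈ Set.Icc (0:ℝ) 1) (hc : 0 ≤ c) {δ : ℝ} (hδ : 0 < δ)
    (hq : ∀ j, q j = (r j * θ j - δ) / r j) :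
    ∃ C : ℝ, 0 ≤ C ∧ ∀ (x : Fin K → ℕ → ℝ) (L sel : ℕ → Fin K) (w : ℝ),
      IsORSPath r c x L sel → Concentrated θ q x w →
      ∀ k b : Fin K, b ∈ neighborhood k → r k * θ k + 4 * δ ≤ r b * θ b →
        (∀ j ∈ neighborhood k, j ≠ b → r j * θ j ≤ r k * θ k) →
        ∀ T, (countBefore L k T : ℝ) ≤ C * (1 + w) := by
  classical
  set R := ∑ k, r k with hR
  set t0 := (R / δ) ^ 4 with ht0
  set A := 2 * (R / δ) ^ 2 * (1 + c) with hA
  have ht0' : 0 ≤ t0 := by positivity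
  have hA' : 0 ≤ A := by positivity
  -- Chosen so that `K A log N ≤ N / 3` up to a constant; with the forced third, a third of `N`
  -- survives absorption.
  set a : ℝ := 1 / (3 * (K * A + 1)) with ha
  have ha' : 0 < a := by positivity
  have hKA : K * A * a ≤ 1 / 3 := by
    rw [ha, mul_one_div, div_le_div_iff₀ (by positivity) (by norm_num)]
    linarith
  refine ⟨3 * (K + (3 * (1 + t0) + 3 * K + 5) + 1 / 3 + K * (1 + t0 + 1) + K * A * |Real.log a|),
    by positivity, ?_⟩
  intro x L sel w path hx k b hb hkb hbest T
  have hw := hx.nonneg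
  set N := countBefore L k T with hN
  set B1 := 3 * (w + t0) + 3 * K + 4 with hB1
  have hB1' : 0 ≤ B1 := by positivity
  set S := (Finset.Ico 1 T).filter (fun n => L n = k) with hS
  set S1 := S.filter (fun n => n ≤ K)
  set S2 := S.filter (fun n => (countBefore L k n : ℝ) ≤ B1) with hS2
  set S3 := S.filter (fun n => ∃ m : ℕ, countBefore L k n = 3 * m + 1) with hS3
  set S4 : Fin K → Finset ℕ := fun j => S.filter (fun n => sel n = j ∧
    (countBefore sel j n : ℝ) ≤ w + t0 + A * Real.log N) with hS4
  have hcover : S ⊆ S1 ∪ S2 ∪ S3 ∪ Finset.univ.biUnion S4 := by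
    intro n hn
    by_cases h1 : n ≤ K
    · simp [S1, hn, h1]
    by_cases h2 : (countBefore L k n : ℝ) ≤ B1
    · simp [S2, hn, h2]
    by_cases h3 : ∃ m : ℕ, countBefore L k n = 3 * m + 1
    · have : n ∈ S3 := Finset.mem_filter.2 ⟨hn, h3⟩
      simp [this]
    have hn' := Finset.mem_filter.1 hn
    have hnT := Finset.mem_Ico.1 hn'.1
    have key := countBefore_sel_le_of_suboptimal_leader hr hθ hc hδ hq path hx hb hkb hbest
      (not_le.1 h1) hn'.2 h3 (not_le.1 h2)
    have : n ∈ S4 (sel n) := by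
      refine Finset.mem_filter.2 ⟨hn, rfl, key.trans ?_⟩
      have h0 : (0 : ℝ) < countBefore L k n := hB1'.trans_lt (not_le.1 h2)
      have : (countBefore L k n : ℝ) ≤ N := by exact_mod_cast countBefore_mono L k hnT.2.le
      gcongr
    simp only [Finset.mem_union, Finset.mem_biUnion]
    exact Or.inr ⟨sel n, Finset.mem_univ _, this⟩
  have hSm : ∀ n ∈ S, 1 ≤ n ∧ n < T ∧ L n = k := fun n hn => by
    have hn' := Finset.mem_filter.1 hn
    have hnT := Finset.mem_Ico.1 hn'.1
    exact ⟨hnT.1, hnT.2, hn'.2⟩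
  have hlogN : 0 ≤ Real.log N := Real.log_natCast_nonneg N
  have c1 : (S1.card : ℝ) ≤ K := by
    have : S1 ⊆ Finset.Icc 1 K := fun n hn => by
      have hn' := Finset.mem_filter.1 hn
      exact Finset.mem_Icc.2 ⟨(hSm n hn'.1).1, hn'.2⟩
    have := Finset.card_le_card this
    rw [Nat.card_Icc] at this
    exact_mod_cast (by omega : S1.card ≤ K)
  have c2 : (S2.card : ℝ) ≤ B1 + 1 :=
    card_le_of_countBefore_le (a := L) (k := k) (fun n hn => by
      have := hSm n (Finset.mem_filter.1 hn).1
      exact ⟨this.1, this.2.2⟩) hB1' (fun n hn => (Finset.mem_filter.1 hn).2)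
  have c3 : (S3.card : ℝ) ≤ (N + 1) / 3 := card_forced_le L k (fun n hn => by
      have := hSm n (Finset.mem_filter.1 hn).1
      exact ⟨this.1, this.2.1, this.2.2, (Finset.mem_filter.1 hn).2⟩)
  have c4 : ∀ j, ((S4 j).card : ℝ) ≤ w + t0 + A * Real.log N + 1 := fun j =>
    card_le_of_countBefore_le (a := sel) (k := j) (fun n hn => by
      have := hSm n (Finset.mem_filter.1 hn).1
      exact ⟨this.1, (Finset.mem_filter.1 hn).2.1⟩) (by positivity)
      (fun n hn => (Finset.mem_filter.1 hn).2.2)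
  have c5 : ((Finset.univ.biUnion S4).card : ℝ) ≤ K * (w + t0 + A * Real.log N + 1) := by
    calc ((Finset.univ.biUnion S4).card : ℝ) ≤ ∑ j, ((S4 j).card : ℝ) := by
          exact_mod_cast Finset.card_biUnion_le
      _ ≤ ∑ j : Fin K, (w + t0 + A * Real.log N + 1) := Finset.sum_le_sum fun j _ => c4 j
      _ = _ := by rw [Finset.sum_const, Finset.card_univ, Fintype.card_fin, nsmul_eq_mul]
  have c0 : (N : ℝ) ≤ S1.card + S2.card + S3.card + (Finset.univ.biUnion S4).card := by
    have h1 : N ≤ (S1 ∪ S2 ∪ S3 ∪ Finset.univ.biUnion S4).card := Finset.card_le_card hcover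
    have h2 := Finset.card_union_le (S1 ∪ S2 ∪ S3) (Finset.univ.biUnion S4)
    have h3 := Finset.card_union_le (S1 ∪ S2) S3
    have h4 := Finset.card_union_le S1 S2
    exact_mod_cast (by omega : N ≤ S1.card + S2.card + S3.card + (Finset.univ.biUnion S4).card)
  have hlog := mul_le_mul_of_nonneg_left (log_natCast_le ha' N) (by positivity : 0 ≤ K * A)
  have hN3 := mul_le_mul_of_nonneg_right hKA (Nat.cast_nonneg N : (0 : ℝ) ≤ N)
  have hKn : (0 : ℝ) ≤ K := Nat.cast_nonneg K
  have hmain : (N : ℝ) ≤ 3 * (K + (B1 + 1) + 1 / 3 + K * (w + t0 + 1) + K * A * |Real.log a|) := by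
    nlinarith
  refine hmain.trans ?_
  have e1 : 0 ≤ K * A * |Real.log a| := by positivity
  have e2 : 0 ≤ w * (K : ℝ) := by positivity
  have e3 : 0 ≤ w * t0 := by positivity
  have e4 : 0 ≤ w * (K * A * |Real.log a|) := by positivity
  have e5 : 0 ≤ w * t0 * (K : ℝ) := by positivity
  rw [hB1]
  nlinarith

/-! ### Selections of a suboptimal neighbour of the optimal leader -/

theorem IsORSPath.empiricalMean_leader_le_index (path : IsORSPath r c x L sel)
    (hr : ∀ k, 0 < r k) (hc : 0 ≤ c) (hx : ∀ k i, x k i = 0 ∨ x k i = 1) {n : ℕ} (hn : K < n)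
    (hne : sel n ≠ L n) (hl : 3 ≤ countBefore L (L n) n) :
    empiricalMean r x sel (L n) n ≤ index r c x L sel (sel n) n := by
  obtain ⟨-, h⟩ := path.select_index n hn fun hm => hne (path.select_leader n hn hm)
  refine le_trans ?_ (h (L n) (Or.inl rfl))
  refine empiricalMean_le_index (hr _) (hx _) (by omega) ?_
  exact (Real.log_natCast_nonneg _).trans (log_le_explorationLevel hc hl)

/-- `RarelySelected r θ q c s k A`: apart from boundedly many exceptions, `k` is selected
under the leader `s` only if it has been selected at most `A` times the exploration level. -/
def RarelySelected (r θ q : Fin K → ℝ) (c : ℝ) (s k : Fin K) (A : ℝ) : Prop :=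
  ∃ C : ℝ, 0 ≤ C ∧ ∀ (x : Fin K → ℕ → ℝ) (L sel : ℕ → Fin K) (w : ℝ),
    IsORSPath r c x L sel → Concentrated θ q x w →
    ∀ n, K < n → L n = s → sel n = k → C * (1 + w) < countBefore L s n →
      3 ≤ countBefore L s n ∧
        (countBefore sel k n : ℝ) ≤ C * (1 + w) + A * explorationLevel c (countBefore L s n)

theorem RarelySelected.exists_card_le {s k : Fin K} {A : ℝ} (h : RarelySelected r θ q c s k A)
    (hc : 0 ≤ c) (hA : 0 ≤ A) :
    ∃ C : ℝ, 0 ≤ C ∧ ∀ (x : Fin K → ℕ → ℝ) (L sel : ℕ → Fin K) (w : ℝ),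
      IsORSPath r c x L sel → Concentrated θ q x w → ∀ T : ℕ,
        (((Finset.Ico 1 (T + 1)).filter (fun n => L n = s ∧ sel n = k)).card : ℝ) ≤
          C * (1 + w) + A * (Real.log T + c * |Real.log (Real.log T)|) := by
  obtain ⟨C, hC, h⟩ := h
  refine ⟨K + 2 * C + 2, by positivity, fun x L sel w path hx T => ?_⟩
  have hw := hx.nonneg
  have hF : 0 ≤ Real.log T + c * |Real.log (Real.log T)| :=
    add_nonneg (Real.log_natCast_nonneg T) (by positivity)
  set F := Real.log T + c * |Real.log (Real.log T)|
  set S := (Finset.Ico 1 (T + 1)).filter (fun n => L n = s ∧ sel n = k) with hS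
  set S1 := S.filter (fun n => n ≤ K)
  set S2 := S.filter (fun n => (countBefore L s n : ℝ) ≤ C * (1 + w))
  set S3 := S.filter (fun n => (countBefore sel k n : ℝ) ≤ C * (1 + w) + A * F)
  have hSm : ∀ n ∈ S, 1 ≤ n ∧ n ≤ T ∧ L n = s ∧ sel n = k := fun n hn => by
    have hn' := Finset.mem_filter.1 hn
    have hnT := Finset.mem_Ico.1 hn'.1
    exact ⟨hnT.1, by omega, hn'.2⟩
  have hcover : S ⊆ S1 ∪ S2 ∪ S3 := by
    intro n hn
    by_cases h1 : n ≤ K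
    · simp [S1, hn, h1]
    by_cases h2 : (countBefore L s n : ℝ) ≤ C * (1 + w)
    · simp [S2, hn, h2]
    obtain ⟨-, hnT, hL, hs⟩ := hSm n hn
    obtain ⟨h3, h4⟩ := h x L sel w path hx n (not_le.1 h1) hL hs (not_le.1 h2)
    have : n ∈ S3 := by
      refine Finset.mem_filter.2 ⟨hn, h4.trans ?_⟩
      gcongr
      exact explorationLevel_le hc (by omega) ((countBefore_le L s n).trans hnT)
    simp [this]
  have c1 : (S1.card : ℝ) ≤ K := by
    have : S1 ⊆ Finset.Icc 1 K := fun n hn => by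
      have hn' := Finset.mem_filter.1 hn
      exact Finset.mem_Icc.2 ⟨(hSm n hn'.1).1, hn'.2⟩
    have := Finset.card_le_card this
    rw [Nat.card_Icc] at this
    exact_mod_cast (by omega : S1.card ≤ K)
  have c2 : (S2.card : ℝ) ≤ C * (1 + w) + 1 :=
    card_le_of_countBefore_le (a := L) (k := s) (fun n hn => by
      have := hSm n (Finset.mem_filter.1 hn).1
      exact ⟨this.1, this.2.2.1⟩) (by positivity) (fun n hn => (Finset.mem_filter.1 hn).2)
  have c3 : (S3.card : ℝ) ≤ C * (1 + w) + A * F + 1 :=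
    card_le_of_countBefore_le (a := sel) (k := k) (fun n hn => by
      have := hSm n (Finset.mem_filter.1 hn).1
      exact ⟨this.1, this.2.2.2⟩) (by positivity) (fun n hn => (Finset.mem_filter.1 hn).2)
  have c0 : (S.card : ℝ) ≤ S1.card + S2.card + S3.card := by
    have h1 := Finset.card_le_card hcover
    have h3 := Finset.card_union_le (S1 ∪ S2) S3
    have h4 := Finset.card_union_le S1 S2
    exact_mod_cast (by omega : S.card ≤ S1.card + S2.card + S3.card)
  have : 0 ≤ (K : ℝ) * w := by positivity
  linarith

/-- An index never exceeds its rate, while the accurate mean of the leader `s` already exceeds `r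
k`. -/
theorem rarelySelected_of_rate_lt (hr : ∀ k, 0 < r k) (hc : 0 ≤ c) {s k : Fin K} (hks : k ≠ s)
    (h : r k < r s * θ s) : RarelySelected r θ q c s k 0 := by
  have hδ : 0 < r s * θ s - r k := by linarith
  set t0 := ((∑ k, r k) / (r s * θ s - r k)) ^ 4 with ht0
  have ht0' : 0 ≤ t0 := by positivity
  refine ⟨3 * (1 + t0) + 3 * K + 4, by positivity, ?_⟩
  intro x L sel w path hx n hn hL hs hl
  subst hL hs
  exfalso
  have hw := hx.nonneg
  have hK : (0 : ℝ) ≤ K := Nat.cast_nonneg K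
  have hwK : 0 ≤ w * K := by positivity
  have hwt : 0 ≤ w * t0 := by positivity
  have hC : 3 * (w + t0) + 3 * K + 4 ≤ (3 * (1 + t0) + 3 * K + 4) * (1 + w) := by nlinarith
  have ht := path.countBefore_leader_le (L n) n
  have h3 : 3 ≤ countBefore L (L n) n := by
    have : (3 : ℝ) < countBefore L (L n) n := by linarith
    exact_mod_cast this.le
  have h1 := path.empiricalMean_leader_le_index hr hc hx.binary hn hks h3
  have h2 := abs_lt.1 (hx.abs_sub_lt (j := L n) (t := countBefore sel (L n) n) hr hδ
    (by linarith) (by linarith))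
  rw [empiricalMean_eq] at h1
  obtain ⟨y, hy, hlt⟩ := exists_mem_indexSet_gt (hr (sel n)).le
    (lt_of_lt_of_le (by linarith) h1)
  linarith [hy.1.2]

/-- Once both means are accurate, selecting `k` forces its index above `r s * θ s - η * r k` while
its mean is at most `θ k + η`; monotonicity of the divergence then bounds its count. -/
theorem rarelySelected_of_lt_rate (hr : ∀ k, 0 < r k) (hc : 0 ≤ c) (hθ : ∀ k, θ k ∈ Set.Icc (0:ℝ) 1)
    {s k : Fin K} (hks : k ≠ s) {η : ℝ} (hη : 0 < η) (h1 : θ k + η < r s * θ s / r k - η)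
    (h2 : r s * θ s / r k - η < 1) :
    RarelySelected r θ q c s k (1 / klReal (θ k + η) (r s * θ s / r k - η)) := by
  have hδ : 0 < η * r k := mul_pos hη (hr k)
  set t0 := ((∑ k, r k) / (η * r k)) ^ 4 with ht0
  have ht0' : 0 ≤ t0 := by positivity
  have hθk := hθ k
  have hI : 0 < klReal (θ k + η) (r s * θ s / r k - η) := by
    refine lt_of_lt_of_le ?_ (half_sq_sub_le_klReal (by linarith [hθk.1]) (by linarith)
      (by linarith [hθk.1]) h2)
    have : θ k + η - (r s * θ s / r k - η) ≠ 0 := by linarith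
    positivity
  refine ⟨3 * (1 + t0) + 3 * K + 4, by positivity, ?_⟩
  intro x L sel w path hx n hn hL hs hl
  have hw := hx.nonneg
  have hK : (0 : ℝ) ≤ K := Nat.cast_nonneg K
  have hwK : 0 ≤ w * K := by positivity
  have hwt : 0 ≤ w * t0 := by positivity
  have hC : 3 * (w + t0) + 3 * K + 4 ≤ (3 * (1 + t0) + 3 * K + 4) * (1 + w) := by nlinarith
  have ht := path.countBefore_leader_le s n
  have h3 : 3 ≤ countBefore L s n := by
    have : (3 : ℝ) < countBefore L s n := by linarith
    exact_mod_cast this.le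
  refine ⟨h3, ?_⟩
  subst hL hs
  have hf := (Real.log_natCast_nonneg _).trans (log_le_explorationLevel hc h3)
  -- The negated bound makes `k` itself sampled often enough for its mean to be accurate.
  by_contra! hcon
  have hcon2 : 0 ≤ 1 / klReal (θ (sel n) + η) (r (L n) * θ (L n) / r (sel n) - η) *
    explorationLevel c (countBefore L (L n) n) := by positivity
  have hi := path.empiricalMean_leader_le_index hr hc hx.binary hn hks h3
  have hd := abs_lt.1 (hx.abs_sub_lt (j := L n) (t := countBefore sel (L n) n) hr hδ
    (by linarith) (by linarith))
  have hd' := abs_lt.1 (hx.abs_sub_lt (j := sel n) (t := countBefore sel (sel n) n) hr hδ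
    (by linarith) (by linarith))
  rw [empiricalMean_eq] at hi
  have hrk := hr (sel n)
  have e : r (L n) * θ (L n) = r (L n) * θ (L n) / r (sel n) * r (sel n) := by field_simp
  obtain ⟨y, hy, hlt⟩ := exists_mem_indexSet_gt
    (y := (r (L n) * θ (L n) / r (sel n) - η) * r (sel n))
    (mul_nonneg (by linarith [hθk.1]) hrk.le)
    (lt_of_lt_of_le (by nlinarith) hi)
  rw [mem_indexSet_iff hrk] at hy
  obtain ⟨hyI, -, hy⟩ := hy
  have hp := phat_mem (hx.binary (sel n)) (countBefore sel (sel n) n)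
  have hp' : phat (x (sel n)) (countBefore sel (sel n) n) ≤ θ (sel n) + η := by
    refine le_of_mul_le_mul_left ?_ hrk
    linarith
  have := mul_klReal_le_of_le (path.one_le_countBefore (sel n) hn) hp.1 (by linarith [hθk.1]) hp'
    h1.le ((le_div_iff₀ hrk).2 hlt.le) h2 (div_le_one_of_le₀ hyI.2 hrk.le) hy
  rw [← le_div_iff₀ hI, div_eq_inv_mul, ← one_div] at this
  have : 0 ≤ (3 * (1 + t0) + 3 * K + 4) * (1 + w) := by positivity
  linarith

theorem neg_mul_log_le_klReal {p v : ℝ} (hp : 0 < p) (hp1 : p < 1) (hv : 0 < v) (hv1 : v < 1) :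
    (1 - p) * -Real.log v - |p * Real.log p + (1 - p) * Real.log (1 - p)| ≤ klReal p (1 - v) := by
  unfold klReal
  rw [sub_sub_cancel, Real.log_div hp.ne' (by linarith), Real.log_div (by linarith) hv.ne']
  have h1 : Real.log (1 - v) ≤ 0 := Real.log_nonpos (by linarith) (by linarith)
  have h2 := mul_nonneg hp.le (neg_nonneg.2 h1)
  linarith [neg_abs_le (p * Real.log p + (1 - p) * Real.log (1 - p))]

/-- The index of `k` must reach `(1 - v) * r k` with `v` of order `l^(-1/4)`, where `l` is the
leader count. The divergence then grows like a multiple of `log l`, as does the exploration level,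
so the count of `k` stays bounded. A fixed accuracy for the leader would give only a small multiple
of `log l`. -/
theorem rarelySelected_of_rate_eq (hr : ∀ k, 0 < r k) (hc : 0 ≤ c)
    (hθ : ∀ k, θ k ∈ Set.Icc (0:ℝ) 1) {s k : Fin K} (hks : k ≠ s) (h : r s * θ s = r k)
    (hθk1 : θ k < 1) : RarelySelected r θ q c s k 0 := by
  obtain ⟨η, hη⟩ : ∃ η, η = (1 - θ k) / 3 := ⟨_, rfl⟩
  have hη0 : 0 < η := by linarith
  have hθk := hθ k
  have hδ : 0 < η * r k := mul_pos hη0 (hr k)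
  obtain ⟨p, hp⟩ : ∃ p, p = θ k + η := ⟨_, rfl⟩
  have hp0 : 0 < p := by linarith [hθk.1]
  have hp1 : p < 1 := by linarith
  obtain ⟨H, hH⟩ : ∃ H, H = |p * Real.log p + (1 - p) * Real.log (1 - p)| := ⟨_, rfl⟩
  have hH0 : 0 ≤ H := hH ▸ abs_nonneg _
  -- For `log l ≥ M`, half of the `(log l) / 4` in `-log v` absorbs all constants, leaving `(log l)
  -- / 8`.
  obtain ⟨M, hM⟩ : ∃ M, M = 8 * (Real.log 6 / 4 + |Real.log (r s / r k)| + H / (1 - p) +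
    |Real.log η|) := ⟨_, rfl⟩
  set t0 := ((∑ k, r k) / (η * r k)) ^ 4 with ht0
  have ht0' : 0 ≤ t0 := by positivity
  have hB0 : 0 ≤ 8 * (1 + c) / (1 - p) := div_nonneg (by positivity) (by linarith)
  refine ⟨3 * (1 + t0) + 6 * K + 4 + Real.exp M + 8 * (1 + c) / (1 - p), by positivity, ?_⟩
  intro x L sel w path hx n hn hL hs hl
  have hw := hx.nonneg
  have hK : (0 : ℝ) ≤ K := Nat.cast_nonneg K
  have hwK : 0 ≤ w * K := by positivity
  have hwt : 0 ≤ w * t0 := by positivity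
  have hwM : 0 ≤ w * Real.exp M := by positivity
  have hwB : 0 ≤ w * (8 * (1 + c) / (1 - p)) := by positivity
  have hM0 := Real.exp_pos M
  have hC : 3 * (w + t0) + 3 + 6 * K + Real.exp M + 8 * (1 + c) / (1 - p) ≤
      (3 * (1 + t0) + 6 * K + 4 + Real.exp M + 8 * (1 + c) / (1 - p)) * (1 + w) := by nlinarith
  have ht := path.countBefore_leader_le s n
  have h3 : 3 ≤ countBefore L s n := by
    have : (3 : ℝ) < countBefore L s n := by linarith
    exact_mod_cast this.le
  refine ⟨h3, ?_⟩
  rw [zero_mul, add_zero]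
  subst hL hs
  by_contra! hcon
  obtain ⟨l, hldef⟩ : ∃ l : ℝ, l = countBefore L (L n) n := ⟨_, rfl⟩
  obtain ⟨t, htdef⟩ : ∃ t : ℝ, t = countBefore sel (L n) n := ⟨_, rfl⟩
  have hl0 : 0 < l := by rw [hldef]; linarith
  have htl : l / 6 ≤ t := by rw [hldef, htdef]; linarith
  have ht0 : 0 < t := by linarith
  have hlogl : M ≤ Real.log l := by
    rw [Real.le_log_iff_exp_le hl0, hldef]; linarith
  have hlogt : Real.log l - Real.log 6 ≤ Real.log t := by
    rw [← Real.log_div hl0.ne' (by norm_num)]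
    exact Real.log_le_log (by positivity) htl
  have hi := path.empiricalMean_leader_le_index hr hc hx.binary hn hks h3
  have hd := abs_lt.1 (hx.abs_sub_lt (j := L n) (t := countBefore sel (L n) n) hr hδ
    (by linarith) (by linarith))
  have hd' := abs_lt.1 (hx.abs_sub_lt (j := sel n) (t := countBefore sel (sel n) n) hr hδ
    (by linarith) (by linarith))
  have hdev := hx.deviation (L n) (countBefore sel (L n) n) (by linarith)
  rw [empiricalMean_eq] at hi
  have hrk := hr (sel n)
  have hrs := hr (L n)
  -- Since `r s * θ s = r k`, this makes `(1 - v) * r k = r s * (θ s - t^(-1/4))`, a lower bound for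
  -- the leader's mean.
  obtain ⟨v, hv⟩ : ∃ v, v = r (L n) / r (sel n) / √(√t) := ⟨_, rfl⟩
  have hss : 0 < √(√t) := by positivity
  have hv0 : 0 < v := by rw [hv]; positivity
  have hlogv : -Real.log v = Real.log t / 4 - Real.log (r (L n) / r (sel n)) := by
    rw [hv, Real.log_div (by positivity) hss.ne', Real.log_sqrt (by positivity),
      Real.log_sqrt ht0.le]
    ring
  have hlogv2 : Real.log l / 8 + H / (1 - p) + |Real.log η| ≤ -Real.log v := by
    rw [hlogv]
    linarith [le_abs_self (Real.log (r (L n) / r (sel n)))]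
  have hHp : 0 ≤ H / (1 - p) := div_nonneg hH0 (by linarith)
  have hlogl0 : 0 < Real.log l := by
    rw [hldef]
    exact Real.log_pos (by exact_mod_cast (by omega : 1 < countBefore L (L n) n))
  have hvη : v ≤ η := by
    rw [← Real.log_le_log_iff hv0 hη0]
    linarith [neg_abs_le (Real.log η)]
  have hphat : θ (L n) - 1 / √(√t) < phat (x (L n)) (countBefore sel (L n) n) := by
    have h4 : |phat (x (L n)) (countBefore sel (L n) n) - θ (L n)| < 1 / √(√t) := by
      refine lt_of_pow_lt_pow_left₀ 4 (by positivity) ?_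
      rw [(show Even 4 by decide).pow_abs]
      have : (√(√t)) ^ 4 = t := by
        rw [show (4 : ℕ) = 2 * 2 by rfl, pow_mul, Real.sq_sqrt (by positivity), Real.sq_sqrt ht0.le]
      rw [div_pow, this, one_pow, lt_div_iff₀ ht0, mul_comm, htdef]
      exact hdev
    linarith [(abs_lt.1 h4).1]
  have hY : (1 - v) * r (sel n) < index r c x L sel (sel n) n := by
    refine lt_of_lt_of_le ?_ hi
    have e : (1 - v) * r (sel n) = r (L n) * (θ (L n) - 1 / √(√t)) := by
      rw [hv, mul_sub, h]
      field_simp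
    rw [e]
    gcongr
  obtain ⟨y, hy, hlt⟩ := exists_mem_indexSet_gt (mul_nonneg (by linarith) hrk.le) hY
  rw [mem_indexSet_iff hrk] at hy
  obtain ⟨hyI, -, hy⟩ := hy
  have hph := phat_mem (hx.binary (sel n)) (countBefore sel (sel n) n)
  have hp' : phat (x (sel n)) (countBefore sel (sel n) n) ≤ p := by
    refine le_of_mul_le_mul_left ?_ hrk
    rw [hp]
    linarith
  have hmain := mul_klReal_le_of_le (path.one_le_countBefore (sel n) hn) hph.1 hp0 hp'
    (by linarith : p ≤ 1 - v) ((le_div_iff₀ hrk).2 hlt.le) (by linarith)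
    (div_le_one_of_le₀ hyI.2 hrk.le) hy
  have hkl := neg_mul_log_le_klReal hp0 hp1 hv0 (by linarith : v < 1)
  rw [← hH] at hkl
  have hkl2 : (1 - p) * (Real.log l / 8) ≤ klReal p (1 - v) := by
    refine le_trans ?_ hkl
    have h5 := mul_le_mul_of_nonneg_left hlogv2 (by linarith : 0 ≤ 1 - p)
    have h6 : (1 - p) * (H / (1 - p)) = H := mul_div_cancel₀ _ (by linarith)
    have h7 := mul_nonneg (by linarith : 0 ≤ 1 - p) (abs_nonneg (Real.log η))
    rw [mul_add, mul_add, h6] at h5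
    linarith
  have h8 := (mul_le_mul_of_nonneg_left hkl2 (Nat.cast_nonneg _)).trans
    (hmain.trans (explorationLevel_le_mul_log hc (by omega)))
  rw [← hldef] at h8
  have h9 : (countBefore sel (sel n) n : ℝ) ≤ 8 * (1 + c) / (1 - p) := by
    rw [le_div_iff₀ (by linarith)]
    refine le_of_mul_le_mul_right ?_ hlogl0
    linarith
  linarith

section Bernoulli

variable {Ω : Type*} [MeasurableSpace Ω] {P : Measure Ω}

/-! ### Deviations of empirical means of Bernoulli variables -/

theorem measurable_phat {Y : ℕ → Ω → ℝ} (hY : ∀ i, Measurable (Y i)) (t : ℕ) :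
    Measurable fun ω => phat (fun i => Y i ω) t := by
  unfold phat
  exact (Finset.measurable_sum _ fun i _ => hY i).div_const _

theorem sum_sub_eq_mul_phat_sub {x : ℕ → ℝ} {a : ℝ} {t : ℕ} (ht : 1 ≤ t) :
    ∑ i ∈ Finset.range t, (x i - a) = t * (phat x t - a) := by
  have : (t : ℝ) ≠ 0 := by positivity
  unfold phat
  rw [Finset.sum_sub_distrib, mul_sub, mul_div_cancel₀ _ this]
  simp

/-- Hoeffding's inequality in both directions at the scale `t^(3/4)` for sums. Being coarser than
`t^(1/2)`, this scale leaves a tail summable even with weight `t`. -/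
theorem measure_deviation_le [IsProbabilityMeasure P] {Y : ℕ → Ω → ℝ} {a : ℝ}
    (hY : ∀ i, Measurable (Y i)) (hbin : ∀ i, ∀ᵐ ω ∂P, Y i ω = 0 ∨ Y i ω = 1)
    (hmean : ∀ i, ∫ ω, Y i ω ∂P = a) (hind : iIndepFun Y P) {t : ℕ} (ht : 1 ≤ t) :
    P {ω | 1 ≤ t * (phat (fun i => Y i ω) t - a) ^ 4} ≤
      ENNReal.ofReal (2 * Real.exp (-2 * √t)) := by
  have ht0 : (0 : ℝ) < t := by exact_mod_cast ht
  have hsub : ∀ i, HasSubgaussianMGF (fun ω => Y i ω - a) ((‖(1 : ℝ) - 0‖₊ / 2) ^ 2) P := by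
    intro i
    have := hasSubgaussianMGF_of_mem_Icc (μ := P) (X := Y i) (a := 0) (b := 1) (hY i).aemeasurable
      (by filter_upwards [hbin i] with ω h; rcases h with h | h <;> simp [h])
    rwa [hmean i] at this
  have hi : iIndepFun (fun i ω => Y i ω - a) P :=
    hind.comp (fun _ y => y - a) fun _ => measurable_id.sub_const a
  have hi' : iIndepFun (fun i => -(fun ω => Y i ω - a)) P :=
    hi.comp (fun _ y => -y) fun _ => measurable_neg
  set ε : ℝ := t / √(√t) with hε
  have hε0 : 0 ≤ ε := by positivity
  have h1 := HasSubgaussianMGF.measure_sum_range_ge_le_of_iIndepFun hi (n := t)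
    (fun i _ => hsub i) hε0
  have h2 := HasSubgaussianMGF.measure_sum_range_ge_le_of_iIndepFun hi' (n := t)
    (fun i _ => (hsub i).neg) hε0
  have hexp : -ε ^ 2 / (2 * t * ((‖(1 : ℝ) - 0‖₊ / 2) ^ 2 : NNReal)) = -2 * √t := by
    have h3 : √(√t) ^ 2 = √t := Real.sq_sqrt (by positivity)
    have h4 : √(t : ℝ) ^ 2 = t := Real.sq_sqrt ht0.le
    have h5 : √(t : ℝ) ≠ 0 := by positivity
    simp only [sub_zero, nnnorm_one, NNReal.coe_pow, NNReal.coe_div, NNReal.coe_one,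
      NNReal.coe_ofNat]
    rw [hε, div_pow, h3]
    field_simp
    nlinarith
  rw [hexp] at h1 h2
  have hsubset : {ω | 1 ≤ t * (phat (fun i => Y i ω) t - a) ^ 4} ⊆
      {ω | ε ≤ ∑ i ∈ Finset.range t, (Y i ω - a)} ∪
      {ω | ε ≤ ∑ i ∈ Finset.range t, (-(fun ω => Y i ω - a)) ω} := by
    intro ω hω
    simp only [Set.mem_ofPred_eq] at hω
    have h3 : 1 / √(√t) ≤ |phat (fun i => Y i ω) t - a| := by
      by_contra! hlt
      have h4 : |phat (fun i => Y i ω) t - a| ^ 4 < (1 / √(√t)) ^ 4 := by gcongr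
      have h5 : (√(√(t : ℝ))) ^ 4 = t := by
        rw [show (4 : ℕ) = 2 * 2 by rfl, pow_mul, Real.sq_sqrt (by positivity), Real.sq_sqrt ht0.le]
      rw [(show Even 4 by decide).pow_abs, div_pow, h5, one_pow, lt_div_iff₀ ht0] at h4
      linarith
    have h6 : ε ≤ t * |phat (fun i => Y i ω) t - a| := by
      rw [hε, div_eq_mul_one_div]
      gcongr
    simp only [Set.mem_union, Set.mem_ofPred_eq, Pi.neg_apply, Finset.sum_neg_distrib]
    rw [sum_sub_eq_mul_phat_sub ht]
    rcases abs_cases (phat (fun i => Y i ω) t - a) with ⟨h, -⟩ | ⟨h, -⟩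
    · left; rwa [h] at h6
    · right; rw [h] at h6; linarith
  rw [two_mul, ENNReal.ofReal_add (by positivity) (by positivity)]
  refine (measure_mono hsubset).trans ((measure_union_le _ _).trans (add_le_add ?_ ?_))
  · exact ENNReal.le_ofReal_iff_toReal_le (measure_ne_top _ _) (by positivity) |>.2 h1
  · exact ENNReal.le_ofReal_iff_toReal_le (measure_ne_top _ _) (by positivity) |>.2 h2

theorem summable_mul_exp_neg_sqrt : Summable fun t : ℕ => (t : ℝ) * (2 * Real.exp (-2 * √t)) := by
  -- The sixth-order term of `exp (2√t)` is `64 t^3 / 720`, so the summand is at most `22.5 / t^2`.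
  refine Summable.of_nonneg_of_le (fun t => by positivity) (fun t => ?_)
    ((Real.summable_one_div_nat_pow.2 one_lt_two).mul_left 23)
  rcases Nat.eq_zero_or_pos t with rfl | ht
  · simp
  have ht0 : (0 : ℝ) < t := by exact_mod_cast ht
  have h := Real.pow_div_factorial_le_exp (2 * √t) (by positivity) 6
  have h4 : √(t : ℝ) ^ 2 = t := Real.sq_sqrt ht0.le
  have h6 : (2 * √(t : ℝ)) ^ 6 = 64 * t ^ 3 := by
    rw [mul_pow, show (6 : ℕ) = 2 * 3 by rfl, pow_mul √(t : ℝ), h4]; norm_num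
  rw [h6, show Nat.factorial 6 = 720 by rfl] at h
  rw [neg_mul, Real.exp_neg, mul_one_div, le_div_iff₀ (by positivity)]
  have hE := Real.exp_pos (2 * √(t : ℝ))
  rw [← div_eq_mul_inv, ← mul_div_assoc, div_mul_eq_mul_div, div_le_iff₀ hE]
  push_cast at h
  nlinarith

/-! ### Evidence against small means -/

/-- The likelihood ratio of the parameters `p` and `q` for the binary outcome `y`. -/
noncomputable def likelihoodRatio (p q y : ℝ) : ℝ := (1 - y) * ((1 - p) / (1 - q)) + y * (p / q)

theorem likelihoodRatio_nonneg {p q y : ℝ} (hp : 0 ≤ p) (hp1 : p ≤ 1) (hq : 0 < q) (hq1 : q < 1)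
    (hy : y = 0 ∨ y = 1) : 0 ≤ likelihoodRatio p q y := by
  have := div_nonneg (sub_nonneg.2 hp1) (sub_pos.2 hq1).le
  rcases hy with rfl | rfl <;> simp [likelihoodRatio] <;> positivity

theorem exp_mul_klReal_phat_eq {x : ℕ → ℝ} (hx : ∀ i, x i = 0 ∨ x i = 1) {q : ℝ}
    {t : ℕ} (ht : 1 ≤ t) (h1 : phat x t < 1) (hq : 0 < q) (hq1 : q < 1) :
    Real.exp (t * klReal (phat x t) q) =
      ∏ i ∈ Finset.range t, likelihoodRatio (phat x t) q (x i) := by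
  have ht0 : (0 : ℝ) < t := by exact_mod_cast ht
  set p := phat x t with hp
  have hsum : ∑ i ∈ Finset.range t, x i = t * p := by
    rw [hp, phat, mul_div_cancel₀ _ ht0.ne']
  have e : t * klReal p q = ∑ i ∈ Finset.range t,
      ((1 - x i) * Real.log ((1 - p) / (1 - q)) + x i * Real.log (p / q)) := by
    rw [Finset.sum_add_distrib, ← Finset.sum_mul, ← Finset.sum_mul, Finset.sum_sub_distrib, hsum]
    simp only [Finset.sum_const, Finset.card_range, nsmul_eq_mul, klReal]
    ring
  rw [e, Real.exp_sum]
  refine Finset.prod_congr rfl fun i hi => ?_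
  rcases hx i with h | h
  · simp only [h, likelihoodRatio, sub_zero, one_mul, zero_mul, add_zero]
    exact Real.exp_log (div_pos (by linarith) (by linarith))
  · have hpos : 0 < p := by
      have : x i ≤ ∑ i ∈ Finset.range t, x i :=
        Finset.single_le_sum (f := x) (fun j _ => by rcases hx j with h | h <;> simp [h]) hi
      rw [hsum, h] at this
      by_contra! hn
      nlinarith
    simp only [h, likelihoodRatio, sub_self, one_mul, zero_mul, zero_add]
    exact Real.exp_log (div_pos hpos hq)

theorem exists_phat_eq {x : ℕ → ℝ} (hx : ∀ i, x i = 0 ∨ x i = 1) (t : ℕ) :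
    ∃ j : ℕ, j ≤ t ∧ phat x t = (j : ℝ) / t := by
  classical
  refine ⟨((Finset.range t).filter (fun i => x i = 1)).card, ?_, ?_⟩
  · exact (Finset.card_filter_le _ _).trans (by simp)
  · unfold phat
    congr 1
    rw [Finset.card_filter, Nat.cast_sum]
    refine Finset.sum_congr rfl fun i _ => ?_
    rcases hx i with h | h <;> simp [h]

/-- The left side is the likelihood ratio at the empirical mean. That mean takes only the values `j
/ t`, so a sum of at most `t + 1` likelihood ratios with fixed parameters dominates it. -/
theorem exp_mul_klReal_phat_le {x : ℕ → ℝ} (hx : ∀ i, x i = 0 ∨ x i = 1) {q : ℝ}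
    {t : ℕ} (ht : 1 ≤ t) (hq : 0 < q) (hq1 : q < 1) (h : phat x t ≤ q) :
    Real.exp (t * klReal (phat x t) q) ≤
      ∑ j ∈ (Finset.range (t + 1)).filter (fun j : ℕ => (j : ℝ) / t ≤ q),
        ∏ i ∈ Finset.range t, likelihoodRatio ((j : ℝ) / t) q (x i) := by
  rw [exp_mul_klReal_phat_eq hx ht (h.trans_lt hq1) hq hq1]
  obtain ⟨j, hj, hpj⟩ := exists_phat_eq hx t
  rw [hpj] at h ⊢
  refine Finset.single_le_sum (f := fun j : ℕ =>
    ∏ i ∈ Finset.range t, likelihoodRatio ((j : ℝ) / t) q (x i)) (fun j hj => ?_)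
    (Finset.mem_filter.2 ⟨Finset.mem_range.2 (by omega), h⟩)
  have := (Finset.mem_filter.1 hj).2
  exact Finset.prod_nonneg fun i _ =>
    likelihoodRatio_nonneg (by positivity) (by linarith) hq hq1 (hx i)

/-- For `p ≤ q` a single factor decreases in the outcome, and its expectation is `1` under mean `q`;
under a mean `a ≥ q` it is at most `1`. -/
theorem lintegral_prod_likelihoodRatio_le [IsProbabilityMeasure P] {Y : ℕ → Ω → ℝ} {a : ℝ}
    (hY : ∀ i, Measurable (Y i)) (hbin : ∀ i, ∀ᵐ ω ∂P, Y i ω = 0 ∨ Y i ω = 1)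
    (hmean : ∀ i, ∫ ω, Y i ω ∂P = a) (hind : iIndepFun Y P) {p q : ℝ} (hp : 0 ≤ p) (hpq : p ≤ q)
    (hq : 0 < q) (hq1 : q < 1) (hqa : q ≤ a) (t : ℕ) :
    ∫⁻ ω, ENNReal.ofReal (∏ i ∈ Finset.range t, likelihoodRatio p q (Y i ω)) ∂P ≤ 1 := by
  have hg : Measurable (fun y => likelihoodRatio p q y) := by unfold likelihoodRatio; fun_prop
  have hone : ∀ i, ∫⁻ ω, ENNReal.ofReal (likelihoodRatio p q (Y i ω)) ∂P ≤ 1 := by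
    intro i
    have hint : Integrable (Y i) P := Integrable.of_mem_Icc 0 1 (hY i).aemeasurable
      (by filter_upwards [hbin i] with ω h; rcases h with h | h <;> simp [h])
    have hint1 : Integrable (fun ω => 1 - Y i ω) P := (integrable_const 1).sub hint
    have hint2 : Integrable (fun ω => likelihoodRatio p q (Y i ω)) P := by
      unfold likelihoodRatio
      exact (hint1.mul_const _).add (hint.mul_const _)
    rw [← ofReal_integral_eq_lintegral_ofReal hint2]
    · have : ∫ ω, likelihoodRatio p q (Y i ω) ∂P = (1 - a) * ((1 - p) / (1 - q)) + a * (p / q) := by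
        unfold likelihoodRatio
        rw [integral_add (hint1.mul_const _) (hint.mul_const _),
          integral_mul_const, integral_mul_const, integral_sub (integrable_const 1) hint, hmean]
        simp
      rw [this, ENNReal.ofReal_le_one]
      have h1 : 1 ≤ (1 - p) / (1 - q) := by rw [le_div_iff₀ (by linarith)]; linarith
      have h2 : p / q ≤ 1 := by rw [div_le_one hq]; exact hpq
      have h3 : (1 - q) * ((1 - p) / (1 - q)) + q * (p / q) = 1 := by
        rw [mul_div_cancel₀ _ (by linarith), mul_div_cancel₀ _ hq.ne']; ring
      nlinarith [mul_nonneg (sub_nonneg.2 hqa) (sub_nonneg.2 (h2.trans h1))]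
    · filter_upwards [hbin i] with ω h
      exact likelihoodRatio_nonneg hp (by linarith) hq hq1 h
  have hprod : ∫⁻ ω, ENNReal.ofReal (∏ i ∈ Finset.range t, likelihoodRatio p q (Y i ω)) ∂P =
      ∫⁻ ω, ∏ i ∈ Finset.range t, ENNReal.ofReal (likelihoodRatio p q (Y i ω)) ∂P := by
    refine lintegral_congr_ae ?_
    filter_upwards [ae_all_iff.2 hbin] with ω h
    exact ENNReal.ofReal_prod_of_nonneg fun i _ =>
      likelihoodRatio_nonneg hp (by linarith) hq hq1 (h i)
  rw [hprod, lintegral_prod_eq_prod_lintegral_of_indepFun (Finset.range t)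
    (fun i ω => ENNReal.ofReal (likelihoodRatio p q (Y i ω)))
    (hind.comp (fun _ y => ENNReal.ofReal (likelihoodRatio p q y)) fun _ => hg.ennreal_ofReal)
    fun i => (hg.comp (hY i)).ennreal_ofReal]
  exact Finset.prod_le_one' fun i _ => hone i

open Classical in
/-- The exponentiated evidence against a mean of at least `q` after `t ≥ 1` observations. -/
noncomputable def evidenceTerm (x : ℕ → ℝ) (q : ℝ) (t : ℕ) : ℝ :=
  if 0 < q ∧ 1 ≤ t ∧ phat x t ≤ q then Real.exp (t * klReal (phat x t) q) else 0

/-- An upper bound for the expectation of `evidenceTerm` under the mean `a`. -/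
noncomputable def evidenceBound (a q : ℝ) (t : ℕ) : ℝ :=
  if 0 < q then (t + 1) * Real.exp (-(((a - q) / 2) ^ 2 / 2)) ^ t else 0

theorem measurable_klReal_left (q : ℝ) : Measurable fun p => klReal p q := by
  unfold klReal
  fun_prop

theorem measurable_evidenceTerm {Y : ℕ → Ω → ℝ} (hY : ∀ i, Measurable (Y i)) (q : ℝ) (t : ℕ) :
    Measurable fun ω => evidenceTerm (fun i => Y i ω) q t := by
  unfold evidenceTerm
  have hp := measurable_phat hY t
  refine Measurable.ite ?_ ?_ measurable_const
  · by_cases h : 0 < q ∧ 1 ≤ t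
    · simpa [h.1, h.2] using measurableSet_le hp measurable_const
    · have : {ω | 0 < q ∧ 1 ≤ t ∧ phat (fun i => Y i ω) t ≤ q} = ∅ := by
        ext ω; simp only [Set.mem_ofPred_eq, Set.mem_empty_iff_false]; tauto
      rw [this]; exact MeasurableSet.empty
  · exact (((measurable_klReal_left q).comp hp).const_mul _).exp

/-- The evidence is compared with that against the midpoint `q'` of `q` and `a`. By `klReal_add_le`
this gains the factor `ρ ^ t`, while the evidence against `q'` still has expectation at most `t +
1`. The strict gap `q < a` thus makes the bounds summable in `t`. -/
theorem lintegral_evidenceTerm_le [IsProbabilityMeasure P] {Y : ℕ → Ω → ℝ} {a : ℝ}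
    (hY : ∀ i, Measurable (Y i)) (hbin : ∀ i, ∀ᵐ ω ∂P, Y i ω = 0 ∨ Y i ω = 1)
    (hmean : ∀ i, ∫ ω, Y i ω ∂P = a) (hind : iIndepFun Y P) {q : ℝ} (hqa : q < a) (ha : a ≤ 1)
    (t : ℕ) :
    ∫⁻ ω, ENNReal.ofReal (evidenceTerm (fun i => Y i ω) q t) ∂P ≤
      ENNReal.ofReal (evidenceBound a q t) := by
  by_cases hq : 0 < q
  swap
  · simp [evidenceTerm, hq]
  rcases Nat.eq_zero_or_pos t with rfl | ht
  · simp [evidenceTerm]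
  set q' := (q + a) / 2 with hq'
  have h1 : q < q' := by linarith
  have h2 : q' ≤ a := by linarith
  have h3 : q' < 1 := by linarith
  set ρ := Real.exp (-(((a - q) / 2) ^ 2 / 2)) with hρ
  have hρ0 : 0 < ρ := Real.exp_pos _
  have hpt : ∀ᵐ ω ∂P, ENNReal.ofReal (evidenceTerm (fun i => Y i ω) q t) ≤
      ENNReal.ofReal (ρ ^ t) *
        ∑ j ∈ (Finset.range (t + 1)).filter (fun j : ℕ => (j : ℝ) / t ≤ q'),
          ENNReal.ofReal (∏ i ∈ Finset.range t, likelihoodRatio ((j : ℝ) / t) q' (Y i ω)) := by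
    filter_upwards [ae_all_iff.2 hbin] with ω hω
    unfold evidenceTerm
    split_ifs with hif
    swap
    · simp
    rw [← ENNReal.ofReal_sum_of_nonneg, ← ENNReal.ofReal_mul (by positivity)]
    · refine ENNReal.ofReal_le_ofReal ?_
      have hA := exp_mul_klReal_phat_le hω ht (by linarith : 0 < q') h3 (hif.2.2.trans h1.le)
      have hB := klReal_add_le hif.2.2 h1.le hq h3
      have hC := half_sq_sub_le_klReal hq.le (by linarith) (by linarith : 0 < q') h3
      have hD : (q - q') ^ 2 / 2 = ((a - q) / 2) ^ 2 / 2 := by rw [hq']; ring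
      have hE : Real.exp (t * klReal (phat (fun i => Y i ω) t) q) ≤
          ρ ^ t * Real.exp (t * klReal (phat (fun i => Y i ω) t) q') := by
        rw [hρ, ← Real.exp_nat_mul, ← Real.exp_add, Real.exp_le_exp, ← mul_add]
        gcongr
        linarith
      exact hE.trans (mul_le_mul_of_nonneg_left hA (by positivity))
    · intro j hj
      have := (Finset.mem_filter.1 hj).2
      exact Finset.prod_nonneg fun i _ =>
        likelihoodRatio_nonneg (by positivity) (by linarith) (by linarith) h3 (hω i)
  have hmeas : ∀ j : ℕ, Measurable fun ω => ENNReal.ofReal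
      (∏ i ∈ Finset.range t, likelihoodRatio ((j : ℝ) / t) q' (Y i ω)) := by
    intro j
    refine (Finset.measurable_prod _ fun i _ => ?_).ennreal_ofReal
    have hg : Measurable (fun y => likelihoodRatio ((j : ℝ) / t) q' y) := by
      unfold likelihoodRatio; fun_prop
    exact hg.comp (hY i)
  refine (lintegral_mono_ae hpt).trans ?_
  rw [lintegral_const_mul _ (Finset.measurable_sum _ fun j _ => hmeas j),
    lintegral_finsetSum _ fun j _ => hmeas j, evidenceBound, if_pos hq,
    mul_comm ((t : ℝ) + 1), ENNReal.ofReal_mul (by positivity)]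
  gcongr
  calc _ ≤ ∑ j ∈ (Finset.range (t + 1)).filter (fun j : ℕ => (j : ℝ) / t ≤ q'), (1 : ENNReal) :=
        Finset.sum_le_sum fun j hj => lintegral_prod_likelihoodRatio_le hY hbin hmean hind
          (by positivity) (Finset.mem_filter.1 hj).2 (by linarith) h3 h2 t
    _ ≤ ∑ j ∈ Finset.range (t + 1), (1 : ENNReal) :=
        Finset.sum_le_sum_of_subset (Finset.filter_subset _ _)
    _ = ENNReal.ofReal ((t : ℝ) + 1) := by
        rw [ENNReal.ofReal_add (by positivity) zero_le_one]
        simp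

theorem summable_evidenceBound {a q : ℝ} (hqa : q < a) : Summable (evidenceBound a q) := by
  unfold evidenceBound
  split_ifs with hq
  · have hρ : ‖Real.exp (-(((a - q) / 2) ^ 2 / 2))‖ < 1 := by
      have : 0 < ((a - q) / 2) ^ 2 := by have := sub_pos.2 hqa; positivity
      rw [Real.norm_eq_abs, Real.abs_exp, Real.exp_lt_one_iff]
      linarith
    have h1 := summable_pow_mul_geometric_of_norm_lt_one 1 hρ
    have h0 := summable_geometric_of_norm_lt_one hρ
    refine (h1.add h0).congr fun t => ?_
    ring
  · exact summable_zero

/-! ### A random time after which the outcomes are concentrated -/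

open Classical in
/-- The contribution of `t` observations to the random time `w`. -/
noncomputable def excess (x : ℕ → ℝ) (a q : ℝ) (t : ℕ) : ENNReal :=
  (if 1 ≤ (t : ℝ) * (phat x t - a) ^ 4 then (t : ENNReal) else 0) +
    ENNReal.ofReal (evidenceTerm x q t)

theorem measurable_excess {Y : ℕ → Ω → ℝ} (hY : ∀ i, Measurable (Y i)) (a q : ℝ) (t : ℕ) :
    Measurable fun ω => excess (fun i => Y i ω) a q t := by
  unfold excess
  refine Measurable.add (Measurable.ite ?_ measurable_const measurable_const)
    (measurable_evidenceTerm hY q t).ennreal_ofReal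
  exact measurableSet_le measurable_const
    ((((measurable_phat hY t).sub_const a).pow_const 4).const_mul _)

theorem lintegral_excess_le [IsProbabilityMeasure P] {Y : ℕ → Ω → ℝ} {a : ℝ}
    (hY : ∀ i, Measurable (Y i)) (hbin : ∀ i, ∀ᵐ ω ∂P, Y i ω = 0 ∨ Y i ω = 1)
    (hmean : ∀ i, ∫ ω, Y i ω ∂P = a) (hind : iIndepFun Y P) {q : ℝ} (hqa : q < a) (ha : a ≤ 1)
    (t : ℕ) :
    ∫⁻ ω, excess (fun i => Y i ω) a q t ∂P ≤
      ENNReal.ofReal (t * (2 * Real.exp (-2 * √t))) + ENNReal.ofReal (evidenceBound a q t) := by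
  unfold excess
  rw [lintegral_add_right _ (measurable_evidenceTerm hY q t).ennreal_ofReal]
  refine add_le_add ?_ (lintegral_evidenceTerm_le hY hbin hmean hind hqa ha t)
  have hm : MeasurableSet {ω | 1 ≤ (t : ℝ) * (phat (fun i => Y i ω) t - a) ^ 4} :=
    measurableSet_le measurable_const
      ((((measurable_phat hY t).sub_const a).pow_const 4).const_mul _)
  have e : ∀ ω, (if 1 ≤ (t : ℝ) * (phat (fun i => Y i ω) t - a) ^ 4 then (t : ENNReal) else 0) =
      {ω | 1 ≤ (t : ℝ) * (phat (fun i => Y i ω) t - a) ^ 4}.indicator (fun _ => (t : ENNReal)) ω :=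
    fun ω => by simp [Set.indicator]
  simp_rw [e]
  rw [lintegral_indicator_const hm]
  rcases Nat.eq_zero_or_pos t with rfl | ht
  · simp
  rw [ENNReal.ofReal_mul (by positivity), ENNReal.ofReal_natCast]
  gcongr
  exact measure_deviation_le hY hbin hmean hind ht

/-- Take for `w` the sum of `excess` over all rates and all `t`: it dominates every evidence term
and every `t` with a large deviation. Its expectation is a sum of terms involving one rate each, so
the joint law across rates plays no role. -/
theorem exists_concentration_time {K : ℕ} {θ q : Fin K → ℝ} (hθ : ∀ k, θ k ≤ 1)
    (hq : ∀ k, q k < θ k) :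
    ∃ C : ℝ, 0 ≤ C ∧ ∀ (Ω : Type u) [MeasurableSpace Ω] (P : Measure Ω) [IsProbabilityMeasure P]
      (X : Fin K → ℕ → Ω → ℝ), IsBernoulliOutcomes P θ X →
      ∃ w : Ω → ℝ, Integrable w P ∧ ∫ ω, w ω ∂P ≤ C ∧
        ∀ᵐ ω ∂P, Concentrated θ q (fun k i => X k i ω) (w ω) := by
  set B : ENNReal := ∑ k, ∑' t : ℕ, (ENNReal.ofReal (t * (2 * Real.exp (-2 * √t))) +
    ENNReal.ofReal (evidenceBound (θ k) (q k) t)) with hB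
  have hBtop : B ≠ ⊤ := by
    rw [hB]
    refine ENNReal.sum_ne_top.2 fun k _ => ?_
    rw [ENNReal.tsum_add]
    exact ENNReal.add_ne_top.2 ⟨summable_mul_exp_neg_sqrt.tsum_ofReal_ne_top,
      (summable_evidenceBound (hq k)).tsum_ofReal_ne_top⟩
  refine ⟨B.toReal, ENNReal.toReal_nonneg, fun Ω _ P _ X hX => ?_⟩
  set W : Ω → ENNReal := fun ω => ∑ k, ∑' t, excess (fun i => X k i ω) (θ k) (q k) t with hW
  have hm : ∀ k t, Measurable fun ω => excess (fun i => X k i ω) (θ k) (q k) t :=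
    fun k t => measurable_excess (hX.measurable k) _ _ t
  have hWm : Measurable W :=
    Finset.measurable_sum _ fun k _ => Measurable.tsum (hm k)
  have hWB : ∫⁻ ω, W ω ∂P ≤ B := by
    rw [hW, lintegral_finsetSum _ fun k _ => Measurable.tsum (hm k)]
    refine Finset.sum_le_sum fun k _ => ?_
    rw [lintegral_tsum fun t => (hm k t).aemeasurable]
    exact ENNReal.tsum_le_tsum fun t => lintegral_excess_le (hX.measurable k) (hX.binary k)
      (hX.mean k) (hX.indep k) (hq k) (hθ k) t
  have hWtop : ∫⁻ ω, W ω ∂P ≠ ⊤ := ne_top_of_le_ne_top hBtop hWB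
  refine ⟨fun ω => (W ω).toReal, integrable_toReal_of_lintegral_ne_top hWm.aemeasurable hWtop,
    ?_, ?_⟩
  · rw [integral_toReal hWm.aemeasurable (ae_lt_top hWm hWtop)]
    exact ENNReal.toReal_mono hBtop hWB
  · have hb : ∀ᵐ ω ∂P, ∀ k i, X k i ω = 0 ∨ X k i ω = 1 :=
      ae_all_iff.2 fun k => ae_all_iff.2 fun i => hX.binary k i
    filter_upwards [ae_lt_top hWm hWtop, hb] with ω hfin hbin
    have hle : ∀ k t, excess (fun i => X k i ω) (θ k) (q k) t ≤ W ω := fun k t =>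
      (ENNReal.le_tsum t).trans (Finset.single_le_sum
        (f := fun k => ∑' t, excess (fun i => X k i ω) (θ k) (q k) t) (fun _ _ => zero_le)
        (Finset.mem_univ k))
    refine ⟨ENNReal.toReal_nonneg, hbin, fun k t ht => ?_, fun k t h0 h1 h2 => ?_⟩
    · by_contra! hcon
      refine absurd ht (not_lt.2 ?_)
      have h := (le_add_right le_rfl).trans (hle k t)
      rw [if_pos hcon] at h
      have := ENNReal.toReal_mono hfin.ne h
      simpa using this
    · have h : ENNReal.ofReal (evidenceTerm (fun i => X k i ω) (q k) t) ≤ W ω :=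
        (le_add_left le_rfl).trans (hle k t)
      rw [evidenceTerm, if_pos ⟨h0, h1, h2⟩] at h
      exact (ENNReal.ofReal_le_iff_le_toReal hfin.ne).1 h

end Bernoulli

variable {s : Fin K}

/-! ### Unimodality -/

/-- The neighbour towards the peak is better, and the one away from it, if any, is worse. -/
theorem exists_better_neighbor (hU : θ ∈ unimodalParams r) (hs : ∀ k, r k * θ k ≤ r s * θ s)
    {k : Fin K} (hk : k ≠ s) :
    r k * θ k < r s * θ s ∧ ∃ b ∈ neighborhood k, r k * θ k < r b * θ b ∧
      ∀ j ∈ neighborhood k, j ≠ b → r j * θ j ≤ r k * θ k := by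
  obtain ⟨-, k₀, hinc, hdec⟩ := hU
  have hlt : ∀ k, k ≠ k₀ → r k * θ k < r k₀ * θ k₀ := by
    intro k hk
    rcases lt_or_gt_of_ne hk with h | h
    · exact hinc h.le (Set.mem_Iic.2 le_rfl) h
    · exact hdec (Set.mem_Ici.2 le_rfl) h.le h
  have hs0 : s = k₀ := by
    by_contra h
    exact absurd (hs k₀) (not_le.2 (hlt s h))
  subst hs0
  refine ⟨hlt k hk, ?_⟩
  rcases lt_or_gt_of_ne hk with h | h
  · have hlt' : k.val + 1 < K := by have := s.isLt; have : k.val < s.val := h; omega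
    set b : Fin K := ⟨k.val + 1, hlt'⟩ with hb
    have hkb : k < b := by rw [Fin.lt_def]; simp [hb]
    have hbs : b ≤ s := by rw [Fin.le_def]; exact h
    refine ⟨b, Or.inr (Or.inr rfl), hinc h.le hbs hkb, fun j hj hjb => ?_⟩
    rcases hj with rfl | hj | hj
    · exact le_rfl
    · have hjk : j < k := by rw [Fin.lt_def]; omega
      exact (hinc (hjk.le.trans h.le) h.le hjk).le
    · exact absurd (Fin.ext hj.symm) hjb
  · have h' : s.val < k.val := h
    set b : Fin K := ⟨k.val - 1, by omega⟩ with hb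
    have hkb : b < k := by rw [Fin.lt_def]; simp only [hb]; omega
    have hbs : s ≤ b := by rw [Fin.le_def]; simp only [hb]; omega
    refine ⟨b, Or.inr (Or.inl (by simp only [hb]; omega)), hdec hbs h.le hkb, fun j hj hjb => ?_⟩
    rcases hj with rfl | hj | hj
    · exact le_rfl
    · exact absurd (Fin.ext (by simp only [hb]; omega)) hjb
    · have hjk : k < j := by rw [Fin.lt_def]; omega
      exact (hdec h.le (h.le.trans hjk.le) hjk).le

theorem exists_uniform_gap (μ : Fin K → ℝ) :
    ∃ δ : ℝ, 0 < δ ∧ ∀ k l, μ k < μ l → μ k + 4 * δ ≤ μ l := by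
  have h : ∀ᶠ δ : ℝ in nhdsWithin 0 (Set.Ioi 0), ∀ k l, μ k < μ l → μ k + 4 * δ ≤ μ l := by
    rw [eventually_all]
    intro k
    rw [eventually_all]
    intro l
    by_cases hkl : μ k < μ l
    · filter_upwards [Ioo_mem_nhdsGT (show (0 : ℝ) < (μ l - μ k) / 4 by linarith)] with δ hδ _
      linarith [hδ.2]
    · exact Eventually.of_forall fun _ h => absurd h hkl
  obtain ⟨δ, h1, h2⟩ := (h.and self_mem_nhdsWithin).exists
  exact ⟨δ, h2, h1⟩

/-! ### The constant in front of the logarithm -/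

theorem mul_log_div {a b : ℝ} (hb : b ≠ 0) :
    a * Real.log (a / b) = a * Real.log a - a * Real.log b := by
  by_cases h : a = 0
  · simp [h]
  · rw [Real.log_div h hb]; ring

theorem tendsto_klReal_add_sub {p q : ℝ} (hq : 0 < q) (hq1 : q < 1) :
    Tendsto (fun η => klReal (p + η) (q - η)) (nhdsWithin 0 (Set.Ioi 0)) (nhds (klReal p q)) := by
  refine Tendsto.mono_left ?_ nhdsWithin_le_nhds
  -- Splitting the logarithms leaves `y log y`, which is continuous at `0`; this covers `p = 0` and
  -- `p = 1`.
  have hev : (fun η : ℝ => (p + η) * Real.log (p + η) - (p + η) * Real.log (q - η) +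
      ((1 - (p + η)) * Real.log (1 - (p + η)) - (1 - (p + η)) * Real.log (1 - (q - η)))) =ᶠ[nhds 0]
      fun η => klReal (p + η) (q - η) := by
    filter_upwards [Ioo_mem_nhds (show q - 1 < (0 : ℝ) by linarith) hq] with η hη
    unfold klReal
    rw [mul_log_div (by linarith [hη.2]), mul_log_div (by linarith [hη.1])]
  have hval : klReal p q = (p + 0) * Real.log (p + 0) - (p + 0) * Real.log (q - 0) +
      ((1 - (p + 0)) * Real.log (1 - (p + 0)) - (1 - (p + 0)) * Real.log (1 - (q - 0))) := by
    simp only [add_zero, sub_zero]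
    unfold klReal
    rw [mul_log_div hq.ne', mul_log_div (by linarith)]
  refine Tendsto.congr' hev ?_
  rw [hval]
  have h1 : Continuous fun η : ℝ => p + η := by fun_prop
  have h2 : Continuous fun η : ℝ => 1 - (p + η) := by fun_prop
  have a1 := (Real.continuous_mul_log.comp h1).tendsto 0
  have a2 := (Real.continuous_mul_log.comp h2).tendsto 0
  have a3 : ContinuousAt (fun η : ℝ => (p + η) * Real.log (q - η)) 0 :=
    h1.continuousAt.mul ((by fun_prop : ContinuousAt (fun η : ℝ => q - η) 0).log (by simpa using hq.ne'))
  have a4 : ContinuousAt (fun η : ℝ => (1 - (p + η)) * Real.log (1 - (q - η))) 0 :=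
    h2.continuousAt.mul ((by fun_prop : ContinuousAt (fun η : ℝ => 1 - (q - η)) 0).log
      (by simp only [sub_zero]; linarith))
  exact (a1.sub a3.tendsto).add (a2.sub a4.tendsto)

open Classical in
/-- The contribution of `k` to `regretConstant r θ s`. -/
noncomputable def regretTerm (r θ : Fin K → ℝ) (s k : Fin K) : ℝ :=
  if k ∈ competitors r θ s then
    (((r s * θ s - r k * θ k : ℝ) : EReal) / bernoulliKL (θ k) (r s * θ s / r k)).toReal
  else 0

theorem regretConstant_eq_sum : regretConstant r θ s = ∑ k, regretTerm r θ s k := by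
  classical
  unfold regretConstant regretTerm
  rw [Finset.sum_filter]

/-- A non-neighbour is never selected under `s` after initialisation. For neighbours the three
positions of `r k` relative to `r s * θ s` give a zero term, a zero term by infinite divergence, and
a term approximated by continuity of the divergence. -/
theorem exists_rarelySelected (hr : ∀ k, 0 < r k) (hc : 0 ≤ c) (hθ : ∀ k, θ k ∈ Set.Icc (0 : ℝ) 1)
    {k : Fin K} (hk : r k * θ k < r s * θ s) {ε : ℝ} (hε : 0 < ε) :
    ∃ A : ℝ, 0 ≤ A ∧ RarelySelected r θ q c s k A ∧
      (r s * θ s - r k * θ k) * A ≤ (1 + ε) * regretTerm r θ s k := by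
  have hks : k ≠ s := by rintro rfl; exact lt_irrefl _ hk
  by_cases hadj : Adjacent s k
  swap
  · refine ⟨0, le_rfl, ⟨0, le_rfl, fun x L sel w path _ n hn hL hs _ => ?_⟩, ?_⟩
    · subst hL hs
      have hm := (path.select_index n hn fun h => hks (path.select_leader n hn h)).1
      rcases hm with h | h
      · exact absurd h hks
      · exact absurd h hadj
    · rw [regretTerm, if_neg (fun h => hadj h.1)]; simp
  rcases lt_trichotomy (r k) (r s * θ s) with h | h | h
  · refine ⟨0, le_rfl, rarelySelected_of_rate_lt hr hc hks h, ?_⟩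
    rw [regretTerm, if_neg (fun hm => absurd hm.2 (not_le.2 h))]; simp
  · have hθk1 : θ k < 1 := by
      have := hr k
      by_contra! hcon
      nlinarith
    refine ⟨0, le_rfl, rarelySelected_of_rate_eq hr hc hθ hks h.symm hθk1, ?_⟩
    rw [regretTerm, if_pos ⟨hadj, h.ge⟩, ← h, div_self (hr k).ne', bernoulliKL_one_of_lt hθk1]
    simp
  · have hθk := hθ k
    have hrk := hr k
    have hpq : θ k < r s * θ s / r k := by rw [lt_div_iff₀ hrk]; linarith
    have hq1 : r s * θ s / r k < 1 := by rw [div_lt_one hrk]; exact h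
    have hq0 : 0 < r s * θ s / r k := by linarith [hθk.1]
    set Q := r s * θ s / r k with hQ
    have hI : 0 < klReal (θ k) Q := by
      refine lt_of_lt_of_le ?_ (half_sq_sub_le_klReal hθk.1 hθk.2 hq0 hq1)
      have : θ k - Q ≠ 0 := by linarith
      positivity
    have hlt : klReal (θ k) Q / (1 + ε) < klReal (θ k) Q := div_lt_self hI (by linarith)
    have hev := (tendsto_klReal_add_sub (p := θ k) hq0 hq1).eventually_const_lt hlt
    obtain ⟨η, hη1, hη2⟩ := (hev.and
      (Ioo_mem_nhdsGT (show (0 : ℝ) < (Q - θ k) / 2 by linarith))).exists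
    have hI0 : 0 < klReal (θ k) Q / (1 + ε) := by positivity
    have hIη : 0 < klReal (θ k + η) (Q - η) := hI0.trans hη1
    refine ⟨1 / klReal (θ k + η) (Q - η), by positivity,
      rarelySelected_of_lt_rate hr hc hθ hks hη2.1 (by linarith [hη2.2]) (by linarith [hη2.1]), ?_⟩
    rw [regretTerm, if_pos ⟨hadj, h.le⟩, bernoulliKL_eq_klReal hq0 hq1, ← EReal.coe_div,
      EReal.toReal_coe]
    have h1 : 1 / klReal (θ k + η) (Q - η) ≤ (1 + ε) / klReal (θ k) Q := by
      have := one_div_le_one_div_of_le hI0 hη1.le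
      rwa [one_div_div] at this
    calc (r s * θ s - r k * θ k) * (1 / klReal (θ k + η) (Q - η))
        ≤ (r s * θ s - r k * θ k) * ((1 + ε) / klReal (θ k) Q) := by
          gcongr
      _ = (1 + ε) * ((r s * θ s - r k * θ k) / klReal (θ k) Q) := by ring

theorem regretTerm_self : regretTerm r θ s s = 0 := by
  rw [regretTerm, if_neg]
  rintro ⟨h | h, -⟩ <;> omega

theorem regretTerm_nonneg (hr : ∀ k, 0 < r k) (hθ : ∀ k, θ k ∈ Set.Icc (0 : ℝ) 1)
    (hlt : ∀ k, k ≠ s → r k * θ k < r s * θ s) (k : Fin K) : 0 ≤ regretTerm r θ s k := by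
  by_cases hk : k = s
  · rw [hk, regretTerm_self]
  · obtain ⟨A, hA, -, h⟩ := exists_rarelySelected (q := θ) hr le_rfl hθ (hlt k hk) one_pos
    have := mul_nonneg (sub_nonneg.2 (hlt k hk).le) hA
    linarith

theorem regretConstant_nonneg (hr : ∀ k, 0 < r k) (hθ : ∀ k, θ k ∈ Set.Icc (0 : ℝ) 1)
    (hlt : ∀ k, k ≠ s → r k * θ k < r s * θ s) : 0 ≤ regretConstant r θ s := by
  rw [regretConstant_eq_sum]
  exact Finset.sum_nonneg fun k _ => regretTerm_nonneg hr hθ hlt k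

/-! ### Regret along a path -/

theorem countBefore_sel_le (L sel : ℕ → Fin K) (s k : Fin K) (T : ℕ) :
    countBefore sel k (T + 1) ≤ ∑ j ∈ Finset.univ.erase s, countBefore L j (T + 1) +
      ((Finset.Ico 1 (T + 1)).filter (fun n => L n = s ∧ sel n = k)).card := by
  unfold countBefore
  have hsub : (Finset.Ico 1 (T + 1)).filter (fun n => sel n = k) ⊆
      (Finset.univ.erase s).biUnion (fun j => (Finset.Ico 1 (T + 1)).filter (fun n => L n = j)) ∪
      (Finset.Ico 1 (T + 1)).filter (fun n => L n = s ∧ sel n = k) := by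
    intro n hn
    rw [Finset.mem_filter] at hn
    rw [Finset.mem_union, Finset.mem_biUnion, Finset.mem_filter]
    by_cases h : L n = s
    · exact Or.inr ⟨hn.1, h, hn.2⟩
    · exact Or.inl ⟨L n, by simp [h], by simp [hn.1, -Finset.mem_Ico]⟩
  exact (Finset.card_le_card hsub).trans ((Finset.card_union_le _ _).trans
    (add_le_add Finset.card_biUnion_le le_rfl))

theorem exists_path_regret_le (hr : ∀ k, 0 < r k) (hc : 0 ≤ c) (hθ : ∀ k, θ k ∈ Set.Icc (0 : ℝ) 1)
    (hlt : ∀ k, k ≠ s → r k * θ k < r s * θ s) {CL : ℝ} (hCL : 0 ≤ CL)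
    (hlead : ∀ (x : Fin K → ℕ → ℝ) (L sel : ℕ → Fin K) (w : ℝ),
      IsORSPath r c x L sel → Concentrated θ q x w →
      ∀ k, k ≠ s → ∀ T, (countBefore L k T : ℝ) ≤ CL * (1 + w))
    {ε : ℝ} (hε : 0 < ε) :
    ∃ C : ℝ, 0 ≤ C ∧ ∀ (x : Fin K → ℕ → ℝ) (L sel : ℕ → Fin K) (w : ℝ),
      IsORSPath r c x L sel → Concentrated θ q x w → ∀ T : ℕ,
        ∑ k, (r s * θ s - r k * θ k) * countBefore sel k (T + 1) ≤ C * (1 + w) +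
          (1 + ε) * regretConstant r θ s * (Real.log T + c * |Real.log (Real.log T)|) := by
  have hgap : ∀ k, 0 ≤ r s * θ s - r k * θ k := fun k => by
    by_cases hk : k = s
    · rw [hk, sub_self]
    · linarith [hlt k hk]
  have hterm : ∀ k, ∃ C : ℝ, 0 ≤ C ∧ ∀ (x : Fin K → ℕ → ℝ) (L sel : ℕ → Fin K) (w : ℝ),
      IsORSPath r c x L sel → Concentrated θ q x w → ∀ T : ℕ,
        (r s * θ s - r k * θ k) * countBefore sel k (T + 1) ≤ C * (1 + w) +
          (1 + ε) * regretTerm r θ s k * (Real.log T + c * |Real.log (Real.log T)|) := by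
    intro k
    by_cases hk : k = s
    · subst hk
      exact ⟨0, le_rfl, fun x L sel w _ _ T => by rw [regretTerm_self]; simp⟩
    obtain ⟨A, hA, hRS, hterm⟩ := exists_rarelySelected (q := q) hr hc hθ (hlt k hk) hε
    obtain ⟨C, hC, h⟩ := hRS.exists_card_le hc hA
    refine ⟨(r s * θ s - r k * θ k) * (K * CL + C),
      mul_nonneg (hgap k) (by positivity), fun x L sel w path hx T => ?_⟩
    have hw := hx.nonneg
    have hF : 0 ≤ Real.log T + c * |Real.log (Real.log T)| :=
      add_nonneg (Real.log_natCast_nonneg T) (by positivity)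
    have h1 : (countBefore sel k (T + 1) : ℝ) ≤
        ∑ j ∈ Finset.univ.erase s, (countBefore L j (T + 1) : ℝ) +
        ((Finset.Ico 1 (T + 1)).filter (fun n => L n = s ∧ sel n = k)).card := by
      exact_mod_cast countBefore_sel_le L sel s k T
    have h2 : ∑ j ∈ Finset.univ.erase s, (countBefore L j (T + 1) : ℝ) ≤ K * (CL * (1 + w)) := by
      calc _ ≤ ∑ j ∈ Finset.univ.erase s, CL * (1 + w) :=
            Finset.sum_le_sum fun j hj => hlead x L sel w path hx j (Finset.ne_of_mem_erase hj) _
        _ ≤ ∑ j : Fin K, CL * (1 + w) :=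
            Finset.sum_le_sum_of_subset_of_nonneg (Finset.erase_subset _ _)
              fun _ _ _ => by positivity
        _ = K * (CL * (1 + w)) := by
            rw [Finset.sum_const, Finset.card_univ, Fintype.card_fin, nsmul_eq_mul]
    have h3 := h x L sel w path hx T
    have h4 := mul_le_mul_of_nonneg_left (h1.trans (add_le_add h2 h3)) (hgap k)
    have h5 := mul_le_mul_of_nonneg_right hterm hF
    linarith
  choose C hC h using hterm
  refine ⟨∑ k, C k, Finset.sum_nonneg fun k _ => hC k, fun x L sel w path hx T => ?_⟩
  rw [regretConstant_eq_sum, Finset.mul_sum, Finset.sum_mul, Finset.sum_mul,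
    ← Finset.sum_add_distrib]
  exact Finset.sum_le_sum fun k _ => h k x L sel w path hx T

/-! ### Expectations -/

theorem measurable_countBefore {Ω : Type*} [MeasurableSpace Ω] {a : ℕ → Ω → Fin K}
    (ha : ∀ n, Measurable (a n)) (k : Fin K) (T : ℕ) :
    Measurable fun ω => (countBefore (fun n => a n ω) k T : ℝ) := by
  unfold countBefore
  simp_rw [Finset.card_filter, Nat.cast_sum]
  refine Finset.measurable_sum _ fun n _ => ?_
  exact (measurable_of_finite fun j : Fin K => (((if j = k then 1 else 0 : ℕ)) : ℝ)).comp (ha n)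

theorem integrable_countBefore {Ω : Type*} [MeasurableSpace Ω] {P : Measure Ω}
    [IsProbabilityMeasure P] {a : ℕ → Ω → Fin K} (ha : ∀ n, Measurable (a n)) (k : Fin K) (T : ℕ) :
    Integrable (fun ω => (countBefore (fun n => a n ω) k T : ℝ)) P :=
  Integrable.of_mem_Icc 0 T (measurable_countBefore ha k T).aemeasurable
    (Eventually.of_forall fun _ => ⟨Nat.cast_nonneg _, by exact_mod_cast countBefore_le _ _ _⟩)

theorem regret_eq_integral {Ω : Type*} [MeasurableSpace Ω] {P : Measure Ω} [IsProbabilityMeasure P]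
    {sel : ℕ → Ω → Fin K} (hsel : ∀ n, Measurable (sel n)) (T : ℕ) :
    regret P r θ s sel T = ∫ ω, ∑ k, (r s * θ s - r k * θ k) *
      (countBefore (fun n => sel n ω) k (T + 1) : ℝ) ∂P := by
  have hint := fun k => integrable_countBefore (P := P) hsel k (T + 1)
  have hsum : ∑ k, ∫ ω, (countBefore (fun n => sel n ω) k (T + 1) : ℝ) ∂P = T := by
    rw [← integral_finsetSum _ fun k _ => hint k]
    have : ∀ ω, ∑ k, (countBefore (fun n => sel n ω) k (T + 1) : ℝ) = T := fun ω => by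
      exact_mod_cast sum_countBefore (fun n => sel n ω) T
    simp [this]
  rw [integral_finsetSum _ fun k _ => (hint k).const_mul _]
  simp_rw [integral_const_mul, sub_mul]
  rw [Finset.sum_sub_distrib, ← Finset.mul_sum, hsum, regret]

theorem tendsto_log_log_natCast :
    Tendsto (fun T : ℕ => Real.log (Real.log (T : ℝ))) atTop atTop :=
  Real.tendsto_log_atTop.comp (Real.tendsto_log_atTop.comp tendsto_natCast_atTop_atTop)

theorem isBigO_const_log_log (a : ℝ) :
    (fun _ : ℕ => a) =O[atTop] (fun T : ℕ => Real.log (Real.log (T : ℝ))) :=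
  (isLittleO_const_left.2 (Or.inr
    (tendsto_norm_atTop_atTop.comp tendsto_log_log_natCast))).isBigO

/-- A regret bound with leading constant `(1 + ε) a` for every `ε` gives the limit bound `a`. -/
theorem limsup_div_log_le {R : ℕ → ℝ} {a : ℝ} (ha : 0 ≤ a)
    (h : ∀ ε : ℝ, 0 < ε → ∃ g : ℕ → ℝ,
      g =O[atTop] (fun T : ℕ => Real.log (Real.log (T : ℝ))) ∧
      ∀ T : ℕ, R T ≤ (1 + ε) * a * Real.log (T : ℝ) + g T) :
    limsup (fun T : ℕ => ((R T / Real.log (T : ℝ) : ℝ) : EReal)) atTop ≤ (a : EReal) := by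
  refine le_of_forall_gt_imp_ge_of_dense fun b hb => ?_
  induction b with
  | bot => exact absurd hb (not_lt.2 bot_le)
  | top => exact le_top
  | coe b =>
    have hab : a < b := by exact_mod_cast hb
    obtain ⟨ε, hε, hεb⟩ : ∃ ε : ℝ, 0 < ε ∧ (1 + ε) * a < b := by
      -- The `+ 1` allows `a = 0`.
      refine ⟨(b - a) / (2 * (a + 1)), div_pos (by linarith) (by linarith), ?_⟩
      have : (b - a) / (2 * (a + 1)) * a ≤ (b - a) / 2 := by
        rw [div_mul_eq_mul_div, div_le_div_iff₀ (by linarith) (by norm_num)]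
        nlinarith
      linarith
    obtain ⟨g, hg, hR⟩ := h ε hε
    have hlog : Tendsto (fun T : ℕ => Real.log (T : ℝ)) atTop atTop :=
      Real.tendsto_log_atTop.comp tendsto_natCast_atTop_atTop
    have ho : g =o[atTop] (fun T : ℕ => Real.log (T : ℝ)) :=
      hg.trans_isLittleO (Real.isLittleO_log_id_atTop.comp_tendsto hlog)
    have hlim := ho.tendsto_div_nhds_zero.eventually_lt_const (sub_pos.2 hεb)
    refine limsup_le_of_le (h := ?_)
    filter_upwards [hlim, hlog.eventually_gt_atTop 0] with T h1 h2
    rw [EReal.coe_le_coe_iff, div_le_iff₀ h2]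
    rw [div_lt_iff₀ h2] at h1
    linarith [hR T]

end RateSelection

/-! ### Assembly of the main theorem -/

open RateSelection
theorem mainTheorem2 {K : ℕ} (r : Fin K → ℝ) (hr_pos : ∀ k, 0 < r k) (hr : StrictMono r)
    (θ : Fin K → ℝ) (hθT : θ ∈ monotoneParams K) (hθU : θ ∈ unimodalParams r)
    (kstar : Fin K) (hkstar : ∀ k, r k * θ k ≤ r kstar * θ kstar)
    (c : ℝ) (hc : 0 < c) :
    (∀ ε : ℝ, 0 < ε →
      ∃ g : ℕ → ℝ, g =O[atTop] (fun T : ℕ => Real.log (Real.log (T : ℝ))) ∧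
        ∀ (Ω : Type u) [MeasurableSpace Ω] (P : Measure Ω) [IsProbabilityMeasure P]
          (X : Fin K → ℕ → Ω → ℝ) (L sel : ℕ → Ω → Fin K), IsORSRun P r θ c X L sel →
          ∀ T : ℕ, regret P r θ kstar sel T ≤
            (1 + ε) * regretConstant r θ kstar * Real.log (T : ℝ) + g T) ∧
    (∀ (Ω : Type u) [MeasurableSpace Ω] (P : Measure Ω) [IsProbabilityMeasure P]
        (X : Fin K → ℕ → Ω → ℝ) (L sel : ℕ → Ω → Fin K), IsORSRun P r θ c X L sel →
        limsup (fun T : ℕ =>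
          ((regret P r θ kstar sel T / Real.log (T : ℝ) : ℝ) : EReal)) atTop ≤
            ((regretConstant r θ kstar : ℝ) : EReal)) ∧
    (∀ k : Fin K, k ≠ kstar →
      ∃ g : ℕ → ℝ, g =O[atTop] (fun T : ℕ => Real.log (Real.log (T : ℝ))) ∧
        ∀ (Ω : Type u) [MeasurableSpace Ω] (P : Measure Ω) [IsProbabilityMeasure P]
          (X : Fin K → ℕ → Ω → ℝ) (L sel : ℕ → Ω → Fin K), IsORSRun P r θ c X L sel →
          ∀ T : ℕ, ∫ ω, (countBefore (fun n => L n ω) k T : ℝ) ∂P ≤ g T) := by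
  have hθ := hθT.1
  have hlt : ∀ k, k ≠ kstar → r k * θ k < r kstar * θ kstar := fun k hk =>
    (exists_better_neighbor hθU hkstar hk).1
  obtain ⟨δ, hδ, hgap⟩ := exists_uniform_gap fun k => r k * θ k
  -- The evidence level corresponds to a throughput `δ` below the true one, matching the slack
  -- allowed for the index of the better neighbour.
  set q : Fin K → ℝ := fun j => (r j * θ j - δ) / r j with hq
  have hqθ : ∀ k, q k < θ k := fun k => by
    rw [hq, div_lt_iff₀ (hr_pos k)]
    linarith
  obtain ⟨CL, hCL, hlead'⟩ := exists_countBefore_suboptimal_leader_le (q := q) hr_pos hθ hc.le hδ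
    fun _ => rfl
  have hlead : ∀ (x : Fin K → ℕ → ℝ) (L sel : ℕ → Fin K) (w : ℝ),
      IsORSPath r c x L sel → Concentrated θ q x w →
      ∀ k, k ≠ kstar → ∀ T, (countBefore L k T : ℝ) ≤ CL * (1 + w) := by
    intro x L sel w path hx k hk T
    obtain ⟨-, b, hb, hkb, hbest⟩ := exists_better_neighbor hθU hkstar hk
    exact hlead' x L sel w path hx k b hb (hgap k b hkb) hbest T
  obtain ⟨CW, hCW, htime⟩ := exists_concentration_time.{u} (q := q) (fun k => (hθ k).2) hqθ
  have hreg : ∀ ε : ℝ, 0 < ε →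
      ∃ g : ℕ → ℝ, g =O[atTop] (fun T : ℕ => Real.log (Real.log (T : ℝ))) ∧
        ∀ (Ω : Type u) [MeasurableSpace Ω] (P : Measure Ω) [IsProbabilityMeasure P]
          (X : Fin K → ℕ → Ω → ℝ) (L sel : ℕ → Ω → Fin K), IsORSRun P r θ c X L sel →
          ∀ T : ℕ, regret P r θ kstar sel T ≤
            (1 + ε) * regretConstant r θ kstar * Real.log (T : ℝ) + g T := by
    intro ε hε
    obtain ⟨C, hC, hpath⟩ := exists_path_regret_le hr_pos hc.le hθ hlt hCL hlead hε
    refine ⟨fun T => C * (1 + CW) +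
      (1 + ε) * regretConstant r θ kstar * c * |Real.log (Real.log T)|,
      (isBigO_const_log_log _).add ((isBigO_refl _ _).abs_left.const_mul_left _), ?_⟩
    intro Ω _ P _ X L sel hrun T
    obtain ⟨w, hwint, hwC, hconc⟩ := htime Ω P X hrun.outcomes
    set D := (1 + ε) * regretConstant r θ kstar * (Real.log T + c * |Real.log (Real.log T)|)
      with hD
    have hint : Integrable (fun ω => C * (1 + w ω) + D) P :=
      (((integrable_const 1).add hwint).const_mul C).add (integrable_const D)
    rw [regret_eq_integral hrun.measurable_sel]
    have h1 : ∫ ω, ∑ k, (r kstar * θ kstar - r k * θ k) *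
        (countBefore (fun n => sel n ω) k (T + 1) : ℝ) ∂P ≤ ∫ ω, (C * (1 + w ω) + D) ∂P := by
      refine integral_mono_ae (integrable_finsetSum _ fun k _ =>
        (integrable_countBefore hrun.measurable_sel k (T + 1)).const_mul _) hint ?_
      filter_upwards [hrun.path, hconc] with ω hω1 hω2
      exact hpath _ _ _ _ hω1 hω2 T
    have h2 : ∫ ω, (C * (1 + w ω) + D) ∂P = C * (1 + ∫ ω, w ω ∂P) + D := by
      have hw1 : Integrable (fun ω => 1 + w ω) P := (integrable_const 1).add hwint
      rw [integral_add (hw1.const_mul C) (integrable_const D), integral_const_mul,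
        integral_add (integrable_const 1) hwint]
      simp
    have h3 : C * (1 + ∫ ω, w ω ∂P) ≤ C * (1 + CW) := by gcongr
    linarith
  refine ⟨hreg, fun Ω _ P _ X L sel hrun => ?_, fun k hk => ?_⟩
  · refine limsup_div_log_le (regretConstant_nonneg hr_pos hθ hlt) fun ε hε => ?_
    obtain ⟨g, hg, h⟩ := hreg ε hε
    exact ⟨g, hg, fun T => h Ω P X L sel hrun T⟩
  -- A constant suffices: the expected time under a suboptimal leader is bounded.
  · refine ⟨fun _ => CL * (1 + CW), isBigO_const_log_log _, fun Ω _ P _ X L sel hrun T => ?_⟩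
    obtain ⟨w, hwint, hwC, hconc⟩ := htime Ω P X hrun.outcomes
    have hint : Integrable (fun ω => 1 + w ω) P := (integrable_const 1).add hwint
    calc ∫ ω, (countBefore (fun n => L n ω) k T : ℝ) ∂P ≤ ∫ ω, CL * (1 + w ω) ∂P := by
          refine integral_mono_ae (integrable_countBefore hrun.measurable_leader k T)
            (hint.const_mul CL) ?_
          filter_upwards [hrun.path, hconc] with ω hω1 hω2
          exact hlead _ _ _ _ hω1 hω2 k hk T
      _ = CL * (1 + ∫ ω, w ω ∂P) := by
          rw [integral_const_mul, integral_add (integrable_const 1) hwint]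
          simp
      _ ≤ CL * (1 + CW) := by gcongr
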